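/- **Theorem (Termination and Deadlock Freedom).** Let $R$ be an $\mathsf{SMLL}$ net (in particular, $R$ may be an $\mathsf{SMLL}^0$ net, i.e. a net without unit links and boxes), and let $M_R$ be its multitoken machine. Then all runs of $M_R$ are finite and end in a final state; moreover, all runs end in one and the same final state $\mathbf F_R$. *Nets.* Formulas are $A ::= 1 \mid \bot \mid X \mid X^\bot \mid A\otimes A \mid A \wp A$ (the last connective is par) with the usual linear negation; positive formulas are $P::=1\mid P\otimes P$, negative ones $N::=\bot\mid N \wp N$. A structure is a finite directed multigraph with edges typed by formulas; each edge has exactly one source link (of which it is a conclusion) and at most one target link (of which it is a premiss). The links are: $\mathsf{ax}$ (conclusions $A,A^\bot$), $\mathsf{cut}$ (premisses $A,A^\bot$), $\otimes$ and $\wp$ (premisses $A,B$, conclusion $A\otimes B$, resp. $A \wp B$), $\mathsf{one}$ (conclusion $1$), sync links ($n\ge 1$ premisses and $n$ corresponding conclusions, the $i$-th premiss and the $i$-th conclusion having the same positive or negative type), and boxes: a box of conclusions $\bot,\Gamma$ contains a structure of conclusions $\Gamma$; its conclusion $\bot$ is its lock. The pending edges at depth $0$ are the conclusions of the structure. The in-edges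 of a sync link are its positive premisses and negative conclusions, its out-edges are its positive conclusions and negative premisses. A structure is correct (a net) if its $0$-graph (its links of depth $0$, each box being one node with the conclusions of the box and without premisses) has no switching cycle, i.e. no undirected simple cycle that uses at most one premiss of each $\wp$ link and at most one out-edge of each sync link, and if the content of each box is correct. *Positions.* The positions are the pairs $(e,m)$ with $e$ an edge and $m\in\{\mathbf l,\mathbf r\}^*$ the address of an occurrence of an atom in the type of $e$ (positive for $1,X$, negative for $\bot,X^\bot$), and the pairs $(e,i)$ with $e$ the lock of a box and $i\in\mathbb N$. $\mathtt{INIT}$ (resp. $\mathtt{FIN}$) is the set of negative (resp. positive) occurrences of atoms in the conclusions of $R$; $\mathtt{ONES}$ is the set of occurrences of $1$ that are conclusions of $\mathsf{one}$ links; $\mathtt{BOTBOX}$ is the set of the pairs $(e,i)$ with $e$ a lock. *Machine.* A state is a function $\mathbf T:\mathtt{INIT}\cup S\to\mathtt{POS}(R)$ with $S\subseteq\mathtt{ONES}$; the initial state $\mathbf I_R$ is the identity on $\mathtt{INIT}$; a state is final if its image is $\mathtt{FIN}\cup B$ for some $B\subseteq\mathtt{BOTBOX}$. A box with lock $e$ is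 unlocked if some $(e,i)$ is in the image of $\mathbf T$. In a transition either one token moves, where a token on a negative position moves upwards and one on a positive position moves downwards: across an axiom or a cut, from $(e,m)$ to $(f,m)$ with $f$ the other edge of the link; across a $\otimes$ or $\wp$ link, between $m$ on the left (right) premiss and $\mathbf l m$ ($\mathbf r m$) on the conclusion; on the lock $e$ of a box, from $(e,\varepsilon)$ to $(e,0)$; across the border of an unlocked box, between the corresponding edges of $\Gamma$ inside and outside. Or, for a sync link all of whose in-edges are saturated (every atom occurrence carries a token), all tokens on the in-edges cross the link simultaneously to the corresponding edges. Or, for a $\mathsf{one}$ link with conclusion $e$ that is active (at depth $0$, or at depth $0$ inside an unlocked box) and with $(e,\varepsilon)\notin\mathrm{dom}(\mathbf T)$, the domain is extended by $(e,\varepsilon)\mapsto(e,\varepsilon)$. A run is a maximal (finite or infinite) sequence of transitions that starts in $\mathbf I_R$. -/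

import Mathlib

namespace SMLL

/-- Formulas of multiplicative linear logic with units; `covar n` is the negation of `var n`. -/
inductive Formula : Type
  | one : Formula
  | bot : Formula
  | var (n : ℕ) : Formula
  | covar (n : ℕ) : Formula
  | tensor (A B : Formula) : Formula
  | par (A B : Formula) : Formula

namespace Formula

/-- Linear negation. -/
def dual : Formula → Formula
  | one => bot
  | bot => one
  | var n => covar n
  | covar n => var n
  | tensor A B => par A.dual B.dual
  | par A B => tensor A.dual B.dual

theorem dual_dual (A : Formula) : A.dual.dual = A := by
  induction A <;> simp_all [dual]

/-- Positive formulas `P ::= 1 | P ⊗ P`. -/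
def IsPositive : Formula → Prop
  | one => True
  | tensor A B => A.IsPositive ∧ B.IsPositive
  | _ => False

/-- Negative formulas `N ::= ⊥ | N ⅋ N`. -/
def IsNegative : Formula → Prop
  | bot => True
  | par A B => A.IsNegative ∧ B.IsNegative
  | _ => False

end Formula

/-- The letters of addresses. -/
inductive Dir : Type
  | left : Dir
  | right : Dir

namespace Formula

/-- `A.PosOcc m`: `m` is the address in `A` of an occurrence of a positive atom (`1` or `X`). -/
def PosOcc : Formula → List Dir → Prop
  | one, [] => True
  | var _, [] => True
  | tensor A _, Dir.left :: m => A.PosOcc m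
  | tensor _ B, Dir.right :: m => B.PosOcc m
  | par A _, Dir.left :: m => A.PosOcc m
  | par _ B, Dir.right :: m => B.PosOcc m
  | _, _ => False

/-- `A.NegOcc m`: `m` is the address in `A` of an occurrence of a negative atom (`⊥` or the
negation of a variable). -/
def NegOcc : Formula → List Dir → Prop
  | bot, [] => True
  | covar _, [] => True
  | tensor A _, Dir.left :: m => A.NegOcc m
  | tensor _ B, Dir.right :: m => B.NegOcc m
  | par A _, Dir.left :: m => A.NegOcc m
  | par _ B, Dir.right :: m => B.NegOcc m
  | _, _ => False

/-- `A.Occ m`: `m` is the address in `A` of an occurrence of an atom. -/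
def Occ (A : Formula) (m : List Dir) : Prop :=
  A.PosOcc m ∨ A.NegOcc m

end Formula

/-- The links, with the edges of type `E` attached to them.

* `ax e f` has the conclusions `e`, `f`;
* `cut e f` has the premisses `e`, `f`;
* `tensor a b c` and `par a b c` have the premisses `a`, `b` (left, right) and the conclusion `c`;
* `one e` has the conclusion `e`;
* `sync ps` has, for every pair `(a, c)` in `ps`, a premiss `a` with corresponding conclusion `c`;
* `box e ds` is a `bot` link together with its box: `e` is the lock, and for every pair `(d, c)` in
  `ds`, `c` is an auxiliary conclusion of the box, and `d` is the corresponding conclusion of the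
  structure contained in the box. -/
inductive Link (E : Type) : Type
  | ax (e f : E) : Link E
  | cut (e f : E) : Link E
  | tensor (a b c : E) : Link E
  | par (a b c : E) : Link E
  | one (e : E) : Link E
  | sync (ps : List (E × E)) : Link E
  | box (lock : E) (doors : List (E × E)) : Link E

namespace Link

variable {E : Type}

/-- The premisses of a link; a box has none. -/
def premisses : Link E → List E
  | ax _ _ => []
  | cut e f => [e, f]
  | tensor a b _ => [a, b]
  | par a b _ => [a, b]
  | one _ => []
  | sync ps => ps.map Prod.fst
  | box _ _ => []

/-- The conclusions of a link; those of a box are its lock and its auxiliary conclusions. -/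
def conclusions : Link E → List E
  | ax e f => [e, f]
  | cut _ _ => []
  | tensor _ _ c => [c]
  | par _ _ c => [c]
  | one e => [e]
  | sync ps => ps.map Prod.snd
  | box e ds => e :: ds.map Prod.snd

/-- The conclusions of the content of a box. -/
def inner : Link E → List E
  | box _ ds => ds.map Prod.fst
  | _ => []

/-- The link is a box. -/
def IsBox (k : Link E) : Prop :=
  ∃ e ds, k = box e ds

/-- The constraints on the types of the premisses and conclusions. -/
def WellTyped (ty : E → Formula) : Link E → Prop
  | ax e f => ty f = (ty e).dual
  | cut e f => ty f = (ty e).dual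
  | tensor a b c => ty c = Formula.tensor (ty a) (ty b)
  | par a b c => ty c = Formula.par (ty a) (ty b)
  | one e => ty e = Formula.one
  | sync ps => ps ≠ [] ∧
      ∀ p ∈ ps, ty p.1 = ty p.2 ∧ ((ty p.1).IsPositive ∨ (ty p.1).IsNegative)
  | box e ds => ty e = Formula.bot ∧ ∀ d ∈ ds, ty d.1 = ty d.2

/-- The in-edges of a sync link: positive premisses and negative conclusions. -/
def InEdge (ty : E → Formula) (ps : List (E × E)) (e : E) : Prop :=
  ∃ p ∈ ps, ((ty p.1).IsPositive ∧ e = p.1) ∨ ((ty p.2).IsNegative ∧ e = p.2)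

/-- The out-edges of a sync link: positive conclusions and negative premisses. -/
def OutEdge (ty : E → Formula) (ps : List (E × E)) (e : E) : Prop :=
  ∃ p ∈ ps, ((ty p.2).IsPositive ∧ e = p.2) ∨ ((ty p.1).IsNegative ∧ e = p.1)

end Link

/-- Structures with boxes, with links `L` and edges `E`. `boxOf l` is the innermost box to which
`l` belongs (`none` if `l` has depth `0`); so the content of a box `b` consists of all links from
which `b` is reached by iterating `boxOf`, and any two boxes are disjoint or nested. A box counts as
a link of the structure in which it lies, not of its own content. -/
structure Structure (L E : Type) : Type where
  ty : E → Formula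
  link : L → Link E
  boxOf : L → Option L
  wellTyped : ∀ l, (link l).WellTyped ty
  /-- Every edge has exactly one source. -/
  source : ∀ e, ∃! l, e ∈ (link l).conclusions
  conclusions_nodup : ∀ l, (link l).conclusions.Nodup
  /-- Every edge has at most one target. -/
  target : ∀ e l l', e ∈ (link l).premisses → e ∈ (link l').premisses → l = l'
  premisses_nodup : ∀ l, (link l).premisses.Nodup
  boxOf_isBox : ∀ l b, boxOf l = some b → (link b).IsBox
  /-- No box belongs to itself. -/
  boxOf_acyclic : ∀ l, ¬ Relation.TransGen (fun k b => boxOf k = some b) l l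
  /-- Edges do not connect a link inside a box with a link outside of it. -/
  premiss_level : ∀ e l l', e ∈ (link l).conclusions → e ∈ (link l').premisses →
    boxOf l = boxOf l'
  inner_nodup : ∀ b, (link b).inner.Nodup
  /-- The conclusions of the content of `b` are the edges of the content at depth `0` that have no
  target. -/
  inner_iff : ∀ b e, e ∈ (link b).inner ↔
    (∃ l, boxOf l = some b ∧ e ∈ (link l).conclusions) ∧ ∀ l, e ∉ (link l).premisses

namespace Structure

variable {L E : Type} (R : Structure L E)

/-- The conclusions of the structure: the pending edges at depth `0`. -/
def IsConclusion (e : E) : Prop :=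
  (∃ l, R.boxOf l = none ∧ e ∈ (R.link l).conclusions) ∧ ∀ l, e ∉ (R.link l).premisses

/-! ### Correctness -/

/-- The edge `e` connects the links `l` and `l'` (in either direction). -/
def Joins (e : E) (l l' : L) : Prop :=
  (e ∈ (R.link l).conclusions ∧ e ∈ (R.link l').premisses) ∨
    (e ∈ (R.link l').conclusions ∧ e ∈ (R.link l).premisses)

/-- A cyclic switching path in the `0`-graph of the content of the box `b` (if `r = some b`) or of
the whole structure (if `r = none`): it visits pairwise different links
`v 0, v 1, …, v n, v 0`, all at depth `0` in that structure, along pairwise different edges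
`d 0, …, d n`, and uses at most one of the premisses of each `par` link and at most one of
the out-edges of each sync link. Addition in `Fin (n + 1)` is cyclic. -/
structure IsSwitchingCycle (r : Option L) (n : ℕ) (v : Fin (n + 1) → L) (d : Fin (n + 1) → E) :
    Prop where
  level : ∀ i, R.boxOf (v i) = r
  links_injective : Function.Injective v
  edges_injective : Function.Injective d
  joins : ∀ i, R.Joins (d i) (v i) (v (i + 1))
  par : ∀ l a b c, R.link l = Link.par a b c → ¬ (a ∈ Set.range d ∧ b ∈ Set.range d)
  sync : ∀ l ps, R.link l = Link.sync ps → ∀ o o', Link.OutEdge R.ty ps o →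
    Link.OutEdge R.ty ps o' → o ∈ Set.range d → o' ∈ Set.range d → o = o'

/-- A structure is correct, that is, a net, if there is no switching cycle in its `0`-graph nor in
the `0`-graph of the content of any of its boxes. -/
def IsNet : Prop :=
  ∀ r n v d, ¬ R.IsSwitchingCycle r n v d

end Structure

/-! ### The multitoken machine -/

/-- Candidates for positions: `atom e m` is the pair of an edge and an address, `lock e i` is the
pair of an edge and a natural number. -/
inductive Pos (E : Type) : Type
  | atom (e : E) (m : List Dir) : Pos E
  | lock (e : E) (i : ℕ) : Pos E

namespace Structure

variable {L E : Type} (R : Structure L E)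

/-- `e` is the lock of a box. -/
def IsLock (e : E) : Prop :=
  ∃ b ds, R.link b = Link.box e ds

/-- The positions of `R`. -/
def POS : Set (Pos E) :=
  {p | (∃ e m, (R.ty e).Occ m ∧ p = Pos.atom e m) ∨ ∃ e i, R.IsLock e ∧ p = Pos.lock e i}

/-- Initial positions: negative occurrences of atoms in the conclusions of `R`. -/
def INIT : Set (Pos E) :=
  {p | ∃ e m, R.IsConclusion e ∧ (R.ty e).NegOcc m ∧ p = Pos.atom e m}

/-- Final positions: positive occurrences of atoms in the conclusions of `R`. -/
def FIN : Set (Pos E) :=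
  {p | ∃ e m, R.IsConclusion e ∧ (R.ty e).PosOcc m ∧ p = Pos.atom e m}

/-- The occurrences of `1` that are conclusions of `one` links. -/
def ONES : Set (Pos E) :=
  {p | ∃ l e, R.link l = Link.one e ∧ p = Pos.atom e []}

/-- The positions `(e, i)` with `e` the lock of a box. -/
def BOTBOX : Set (Pos E) :=
  {p | ∃ e i, R.IsLock e ∧ p = Pos.lock e i}

/-- States: functions from `INIT ∪ S` to `POS`, for some `S ⊆ ONES`, given as partial functions.
`T.tok s = some p` says that the token of origin `s` is on the position `p`. -/
structure State : Type where
  tok : Pos E → Option (Pos E)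
  dom : ∃ S, S ⊆ R.ONES ∧ ∀ s, (∃ p, tok s = some p) ↔ s ∈ R.INIT ∪ S
  pos : ∀ s p, tok s = some p → p ∈ R.POS

open Classical in
/-- The initial state: the identity on `INIT`. -/
noncomputable def initialState : R.State where
  tok s := if s ∈ R.INIT then some s else none
  dom := ⟨∅, Set.empty_subset _, fun s => by by_cases h : s ∈ R.INIT <;> simp [h]⟩
  pos s p h := by
    by_cases hs : s ∈ R.INIT
    · rw [if_pos hs] at h
      cases h
      obtain ⟨e, m, _, hm, rfl⟩ := hs
      exact Or.inl ⟨e, m, Or.inr hm, rfl⟩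
    · rw [if_neg hs] at h
      cases h

variable {R}

namespace State

/-- The image of the state: the positions on which there is a token. -/
def image (T : R.State) : Set (Pos E) :=
  {p | ∃ s, T.tok s = some p}

/-- Final states. -/
def IsFinal (T : R.State) : Prop :=
  ∃ B, B ⊆ R.BOTBOX ∧ T.image = R.FIN ∪ B

/-- There is a token on every position of the edge `e`. -/
def Saturated (T : R.State) (e : E) : Prop :=
  ∀ m, (R.ty e).Occ m → Pos.atom e m ∈ T.image

/-- The box `b` is unlocked. -/
def Unlocked (T : R.State) (b : L) : Prop :=
  ∃ e ds i, R.link b = Link.box e ds ∧ Pos.lock e i ∈ T.image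

/-- The link `l` is active: it is at depth `0`, or at depth `0` inside an unlocked box. -/
def Active (T : R.State) (l : L) : Prop :=
  R.boxOf l = none ∨ ∃ b, R.boxOf l = some b ∧ T.Unlocked b

/-- The moves of one single token from a position to another one, in the state `T`. -/
inductive Move (T : R.State) : Pos E → Pos E → Prop
  | ax_left (l : L) (e f : E) (m : List Dir) : R.link l = Link.ax e f → (R.ty e).NegOcc m →
      Move T (Pos.atom e m) (Pos.atom f m)
  | ax_right (l : L) (e f : E) (m : List Dir) : R.link l = Link.ax e f → (R.ty f).NegOcc m →
      Move T (Pos.atom f m) (Pos.atom e m)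
  | cut_left (l : L) (e f : E) (m : List Dir) : R.link l = Link.cut e f → (R.ty e).PosOcc m →
      Move T (Pos.atom e m) (Pos.atom f m)
  | cut_right (l : L) (e f : E) (m : List Dir) : R.link l = Link.cut e f → (R.ty f).PosOcc m →
      Move T (Pos.atom f m) (Pos.atom e m)
  | down_left (l : L) (a b c : E) (m : List Dir) :
      R.link l = Link.tensor a b c ∨ R.link l = Link.par a b c → (R.ty a).PosOcc m →
      Move T (Pos.atom a m) (Pos.atom c (Dir.left :: m))
  | down_right (l : L) (a b c : E) (m : List Dir) :
      R.link l = Link.tensor a b c ∨ R.link l = Link.par a b c → (R.ty b).PosOcc m →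
      Move T (Pos.atom b m) (Pos.atom c (Dir.right :: m))
  | up_left (l : L) (a b c : E) (m : List Dir) :
      R.link l = Link.tensor a b c ∨ R.link l = Link.par a b c →
      (R.ty c).NegOcc (Dir.left :: m) →
      Move T (Pos.atom c (Dir.left :: m)) (Pos.atom a m)
  | up_right (l : L) (a b c : E) (m : List Dir) :
      R.link l = Link.tensor a b c ∨ R.link l = Link.par a b c →
      (R.ty c).NegOcc (Dir.right :: m) →
      Move T (Pos.atom c (Dir.right :: m)) (Pos.atom b m)
  | unlock (b : L) (e : E) (ds : List (E × E)) : R.link b = Link.box e ds →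
      Move T (Pos.atom e []) (Pos.lock e 0)
  | exit_box (b : L) (e : E) (ds : List (E × E)) (d c : E) (m : List Dir) :
      R.link b = Link.box e ds → (d, c) ∈ ds → T.Unlocked b → (R.ty d).PosOcc m →
      Move T (Pos.atom d m) (Pos.atom c m)
  | enter_box (b : L) (e : E) (ds : List (E × E)) (d c : E) (m : List Dir) :
      R.link b = Link.box e ds → (d, c) ∈ ds → T.Unlocked b → (R.ty c).NegOcc m →
      Move T (Pos.atom c m) (Pos.atom d m)

/-- How a token on an in-edge crosses a sync link, to the corresponding out-edge. -/
inductive Cross (R : Structure L E) (ps : List (E × E)) : Pos E → Pos E → Prop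
  | down (a c : E) (m : List Dir) : (a, c) ∈ ps → (R.ty a).PosOcc m →
      Cross R ps (Pos.atom a m) (Pos.atom c m)
  | up (a c : E) (m : List Dir) : (a, c) ∈ ps → (R.ty c).NegOcc m →
      Cross R ps (Pos.atom c m) (Pos.atom a m)

/-- The transition relation of the machine. -/
inductive Step (T U : R.State) : Prop
  /-- One token moves, all others stay. -/
  | move (s p q : Pos E) : T.tok s = some p → T.Move p q → U.tok s = some q →
      (∀ t, t ≠ s → U.tok t = T.tok t) → Step T U
  /-- If all in-edges of a sync link are saturated, all tokens on them cross simultaneously. -/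
  | sync (l : L) (ps : List (E × E)) : R.link l = Link.sync ps →
      (∀ e, Link.InEdge R.ty ps e → T.Saturated e) →
      (∀ t p q, T.tok t = some p → Cross R ps p q → U.tok t = some q) →
      (∀ t, (∀ p q, T.tok t = some p → ¬ Cross R ps p q) → U.tok t = T.tok t) → Step T U
  /-- A new token appears on the conclusion of an active `one` link. -/
  | one (l : L) (e : E) : R.link l = Link.one e → T.Active l →
      T.tok (Pos.atom e []) = none → U.tok (Pos.atom e []) = some (Pos.atom e []) →
      (∀ t, t ≠ Pos.atom e [] → U.tok t = T.tok t) → Step T U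

end State

variable (R)

/-- Runs: maximal sequences `τ 0 ⟶ τ 1 ⟶ ⋯` of transitions from the initial state. `N` is the
number of transitions, `⊤` for an infinite run; values of `τ` beyond `N` are irrelevant. -/
structure IsRun (N : ℕ∞) (τ : ℕ → R.State) : Prop where
  start : τ 0 = R.initialState
  step : ∀ n : ℕ, (n : ℕ∞) < N → State.Step (τ n) (τ (n + 1))
  maximal : ∀ n : ℕ, N = n → ∀ U, ¬ State.Step (τ n) U

end Structure

end SMLL

/-! Disregard locks and synchronisation. Then a position has at most one successor and at most one
predecessor (`Next.unique_right`, `Next.unique_left`), and the positions in `INIT` and `ONES`, where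
tokens are born, have no predecessor. So tokens follow disjoint paths of a partial injection.
Relative to the set `V` of visited positions (`Inv`), every transition visits a new position
(`Inv.exists_fresh`). Only finitely many positions can be reached, so runs are finite.

For deadlock freedom, consider a stuck state and an unvisited atom on some edge. `Owes` blames
exactly one end of that edge: the source for a positive atom, the target for a negative one; in
conflicts the source loses under `tensor` and the target under `par`. Since no transition is
possible, a blamed link can pass the blame on to a neighbour (`Inv.pass_debt`). By finiteness the
blame runs round a cycle, and this is a switching cycle: a `par` link never receives blame through
one premiss and hands it on through the other, and blame on an out-edge of a sync link always points
at that link. Correctness forbids this (`IsNet.not_forall_debtEdge`). Boxes need two inductions on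
nesting: from the inside out, a content is clear if the outside is not to blame; from the outside
in, every box is unlocked.

Hence every atom has been visited (`Inv.visited`), every `one` link has emitted its token, and every
token stands at the end of its path, on a positive conclusion atom or on a lock. The final state is
therefore determined by `Next` alone (`Inv.tok_iff`), whatever the run. -/

namespace SMLL

/-! ### Occurrences of atoms, and the blame for unvisited ones. -/

namespace Formula

theorem posOcc_dual (A : Formula) (m : List Dir) : A.dual.PosOcc m ↔ A.NegOcc m := by
  induction A generalizing m <;> rcases m with _ | ⟨_ | _, m⟩ <;> simp_all [dual, PosOcc, NegOcc]

theorem negOcc_dual (A : Formula) (m : List Dir) : A.dual.NegOcc m ↔ A.PosOcc m := by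
  rw [← posOcc_dual, dual_dual]

theorem PosOcc.not_negOcc {A : Formula} {m : List Dir} (h : A.PosOcc m) : ¬ A.NegOcc m := by
  induction A generalizing m <;> rcases m with _ | ⟨_ | _, m⟩ <;> simp_all [PosOcc, NegOcc]

theorem IsPositive.not_negOcc {A : Formula} (h : A.IsPositive) (m : List Dir) : ¬ A.NegOcc m := by
  induction A generalizing m <;> rcases m with _ | ⟨_ | _, m⟩ <;>
    simp_all [IsPositive, NegOcc]

theorem IsNegative.not_posOcc {A : Formula} (h : A.IsNegative) (m : List Dir) : ¬ A.PosOcc m := by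
  induction A generalizing m <;> rcases m with _ | ⟨_ | _, m⟩ <;>
    simp_all [IsNegative, PosOcc]

theorem exists_occ (A : Formula) : ∃ m, A.Occ m := by
  induction A with
  | one => exact ⟨[], Or.inl trivial⟩
  | bot => exact ⟨[], Or.inr trivial⟩
  | var => exact ⟨[], Or.inl trivial⟩
  | covar => exact ⟨[], Or.inr trivial⟩
  | tensor A B hA hB => exact hA.imp' (Dir.left :: ·) fun m h => h
  | par A B hA hB => exact hA.imp' (Dir.left :: ·) fun m h => h

theorem finite_occ (A : Formula) : {m | A.Occ m}.Finite := by
  have key (A B C : Formula) (hA : {m | A.Occ m}.Finite) (hB : {m | B.Occ m}.Finite)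
      (h : ∀ m, C.Occ m → (∃ m', A.Occ m' ∧ m = Dir.left :: m') ∨
        ∃ m', B.Occ m' ∧ m = Dir.right :: m') : {m | C.Occ m}.Finite := by
    refine ((hA.image (Dir.left :: ·)).union (hB.image (Dir.right :: ·))).subset fun m hm => ?_
    rcases h m hm with ⟨m', h', rfl⟩ | ⟨m', h', rfl⟩
    · exact Or.inl ⟨m', h', rfl⟩
    · exact Or.inr ⟨m', h', rfl⟩
  have atom (C : Formula) (h : ∀ m, C.Occ m → m = []) : {m | C.Occ m}.Finite :=
    (Set.finite_singleton []).subset h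
  induction A with
  | tensor A B hA hB | par A B hA hB =>
    refine key _ _ _ hA hB fun m hm => ?_
    rcases m with _ | ⟨_ | _, m⟩
    · simp [Occ, PosOcc, NegOcc] at hm
    · exact Or.inl ⟨m, hm, rfl⟩
    · exact Or.inr ⟨m, hm, rfl⟩
  | _ =>
    refine atom _ fun m hm => ?_
    rcases m with _ | ⟨_ | _, m⟩
    · rfl
    · exact (hm.elim id id : False).elim
    · exact (hm.elim id id : False).elim

/-- Let `v` be the set of the visited addresses of atoms in the type `A` of an edge.
`A.Owes true v` says that the source of the edge is to blame for an unvisited atom,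
`A.Owes false v` that its target is. -/
def Owes : Formula → Bool → (List Dir → Prop) → Prop
  | one, b, v => b = true ∧ ¬ v []
  | bot, b, v => b = false ∧ ¬ v []
  | var _, b, v => b = true ∧ ¬ v []
  | covar _, b, v => b = false ∧ ¬ v []
  | tensor A B, true, v =>
      A.Owes true (fun m => v (Dir.left :: m)) ∨ B.Owes true (fun m => v (Dir.right :: m))
  | tensor A B, false, v =>
      (A.Owes false (fun m => v (Dir.left :: m)) ∨ B.Owes false (fun m => v (Dir.right :: m))) ∧
        ¬ A.Owes true (fun m => v (Dir.left :: m)) ∧ ¬ B.Owes true (fun m => v (Dir.right :: m))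
  | par A B, false, v =>
      A.Owes false (fun m => v (Dir.left :: m)) ∨ B.Owes false (fun m => v (Dir.right :: m))
  | par A B, true, v =>
      (A.Owes true (fun m => v (Dir.left :: m)) ∨ B.Owes true (fun m => v (Dir.right :: m))) ∧
        ¬ A.Owes false (fun m => v (Dir.left :: m)) ∧ ¬ B.Owes false (fun m => v (Dir.right :: m))

theorem owes_dual (A : Formula) (b : Bool) (v : List Dir → Prop) :
    A.dual.Owes b v ↔ A.Owes (!b) v := by
  induction A generalizing b v <;> cases b <;> simp_all [dual, Owes]

/-- The negated conjuncts in the clauses `tensor`/`false` and `par`/`true` settle conflicts between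
the two components, so that blame falls on one end only. -/
theorem Owes.not_false {A : Formula} {v : List Dir → Prop} (h : A.Owes true v) :
    ¬ A.Owes false v := by
  induction A generalizing v <;> simp_all [Owes]
  tauto

theorem visited_of_not_owes {A : Formula} {v : List Dir → Prop} (h : ∀ b, ¬ A.Owes b v)
    {m : List Dir} (hm : A.Occ m) : v m := by
  induction A generalizing v m with
  | tensor A B hA hB | par A B hA hB =>
    have h1 := h true
    have h2 := h false
    simp only [Owes] at h1 h2
    rcases m with _ | ⟨_ | _, m⟩
    · simp [Occ, PosOcc, NegOcc] at hm
    · exact hA (v := fun m => v (Dir.left :: m)) (by rintro (_ | _) <;> tauto) hm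
    · exact hB (v := fun m => v (Dir.right :: m)) (by rintro (_ | _) <;> tauto) hm
  | _ =>
    have h1 := h true
    have h2 := h false
    rcases m with _ | ⟨_ | _, m⟩ <;> simp_all [Owes, Occ, PosOcc, NegOcc]

/-- Blame on the target always originates in an unvisited negative atom, whatever the connectives
above it. -/
theorem not_owes_false {A : Formula} {v : List Dir → Prop} (h : ∀ m, A.NegOcc m → v m) :
    ¬ A.Owes false v := by
  induction A generalizing v with
  | tensor A B hA hB | par A B hA hB =>
    have h1 := hA (v := fun m => v (Dir.left :: m)) fun m hm => h _ hm
    have h2 := hB (v := fun m => v (Dir.right :: m)) fun m hm => h _ hm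
    simp [Owes, h1, h2]
  | _ => have h1 := h []; simp_all [Owes, NegOcc]

theorem not_owes_true {A : Formula} {v : List Dir → Prop} (h : ∀ m, A.PosOcc m → v m) :
    ¬ A.Owes true v := by
  rw [← A.dual_dual, owes_dual]
  exact not_owes_false fun m hm => h m ((A.negOcc_dual m).1 hm)

end Formula

/-! ### How a token crosses a single link. -/

namespace Link

variable {E : Type}

/-- `k.Vert a x c`: the address `m` on the edge `a` above or inside the link `k` corresponds to the
address `x ++ m` on the edge `c` below or outside it. -/
def Vert : Link E → E → List Dir → E → Prop
  | tensor a b c, a', x, c' => c' = c ∧ (a' = a ∧ x = [Dir.left] ∨ a' = b ∧ x = [Dir.right])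
  | par a b c, a', x, c' => c' = c ∧ (a' = a ∧ x = [Dir.left] ∨ a' = b ∧ x = [Dir.right])
  | sync ps, a, x, c => x = [] ∧ (a, c) ∈ ps
  | box _ ds, a, x, c => x = [] ∧ (a, c) ∈ ds
  | _, _, _, _ => False

theorem Vert.mem_conclusions {k : Link E} {a c : E} {x : List Dir} (h : k.Vert a x c) :
    c ∈ k.conclusions := by
  cases k <;> simp_all [Vert, conclusions]
  · exact ⟨_, h.2⟩
  · exact Or.inr ⟨_, h.2⟩

theorem Vert.mem_premisses_or_inner {k : Link E} {a c : E} {x : List Dir} (h : k.Vert a x c) :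
    a ∈ k.premisses ∨ a ∈ k.inner := by
  cases k <;> simp_all [Vert, premisses, inner]
  · tauto
  · tauto
  · exact ⟨_, h.2⟩
  · exact ⟨_, h.2⟩

theorem Vert.down_unique {k : Link E} {a c c' : E} {x x' : List Dir} (h1 : k.premisses.Nodup)
    (h2 : k.inner.Nodup) (h : k.Vert a x c) (h' : k.Vert a x' c') : x = x' ∧ c = c' := by
  cases k with
  | tensor | par => simp_all [Vert, premisses]; grind
  | sync ps =>
    exact ⟨h.1.trans h'.1.symm, congrArg Prod.snd (List.inj_on_of_nodup_map h1 h.2 h'.2 rfl)⟩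
  | box _ ds =>
    exact ⟨h.1.trans h'.1.symm, congrArg Prod.snd (List.inj_on_of_nodup_map h2 h.2 h'.2 rfl)⟩
  | _ => exact h.elim

theorem Vert.up_unique {k : Link E} {a a' c : E} {x x' m m' : List Dir} (h1 : k.conclusions.Nodup)
    (h : k.Vert a x c) (h' : k.Vert a' x' c) (hm : x ++ m = x' ++ m') : a = a' ∧ m = m' := by
  cases k with
  | tensor | par =>
    obtain ⟨-, ⟨rfl, rfl⟩ | ⟨rfl, rfl⟩⟩ := h <;> obtain ⟨-, ⟨rfl, rfl⟩ | ⟨rfl, rfl⟩⟩ := h' <;>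
      simp_all
  | sync ps =>
    obtain ⟨rfl, h⟩ := h
    obtain ⟨rfl, h'⟩ := h'
    exact ⟨congrArg Prod.fst (List.inj_on_of_nodup_map h1 h h' rfl), hm⟩
  | box _ ds =>
    obtain ⟨rfl, h⟩ := h
    obtain ⟨rfl, h'⟩ := h'
    exact ⟨congrArg Prod.fst (List.inj_on_of_nodup_map (List.nodup_cons.1 h1).2 h h' rfl), hm⟩
  | _ => exact h.elim

theorem Vert.posOcc_iff {k : Link E} {ty : E → Formula} (hk : k.WellTyped ty) {a c : E}
    {x : List Dir} (h : k.Vert a x c) (m : List Dir) :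
    (ty c).PosOcc (x ++ m) ↔ (ty a).PosOcc m := by
  cases k with
  | tensor | par =>
    obtain ⟨rfl, ⟨rfl, rfl⟩ | ⟨rfl, rfl⟩⟩ := h <;> simp_all [WellTyped, Formula.PosOcc]
  | sync ps => obtain ⟨rfl, h⟩ := h; simp [(hk.2 _ h).1]
  | box _ ds => obtain ⟨rfl, h⟩ := h; simp [hk.2 _ h]
  | _ => exact h.elim

theorem Vert.negOcc_iff {k : Link E} {ty : E → Formula} (hk : k.WellTyped ty) {a c : E}
    {x : List Dir} (h : k.Vert a x c) (m : List Dir) :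
    (ty c).NegOcc (x ++ m) ↔ (ty a).NegOcc m := by
  cases k with
  | tensor | par =>
    obtain ⟨rfl, ⟨rfl, rfl⟩ | ⟨rfl, rfl⟩⟩ := h <;> simp_all [WellTyped, Formula.NegOcc]
  | sync ps => obtain ⟨rfl, h⟩ := h; simp [(hk.2 _ h).1]
  | box _ ds => obtain ⟨rfl, h⟩ := h; simp [hk.2 _ h]
  | _ => exact h.elim

/-- `k.Trav ty p q`: a token crossing the link `k` goes from `p` to `q`. -/
inductive Trav (k : Link E) (ty : E → Formula) : Pos E → Pos E → Prop
  | ax (e f : E) (m : List Dir) : k = Link.ax e f ∨ k = Link.ax f e → (ty e).NegOcc m →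
      Trav k ty (Pos.atom e m) (Pos.atom f m)
  | cut (e f : E) (m : List Dir) : k = Link.cut e f ∨ k = Link.cut f e → (ty e).PosOcc m →
      Trav k ty (Pos.atom e m) (Pos.atom f m)
  | down (a : E) (x : List Dir) (c : E) (m : List Dir) : k.Vert a x c → (ty a).PosOcc m →
      Trav k ty (Pos.atom a m) (Pos.atom c (x ++ m))
  | up (a : E) (x : List Dir) (c : E) (m : List Dir) : k.Vert a x c → (ty a).NegOcc m →
      Trav k ty (Pos.atom c (x ++ m)) (Pos.atom a m)
  | unlock (e : E) (ds : List (E × E)) : k = Link.box e ds →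
      Trav k ty (Pos.atom e []) (Pos.lock e 0)

/-- The position `p` is one on which a token enters the link `k`. -/
def Enters (k : Link E) (ty : E → Formula) (p : Pos E) : Prop :=
  ∃ e m, p = Pos.atom e m ∧ ((e ∈ k.conclusions ∧ (ty e).NegOcc m) ∨
    ((e ∈ k.premisses ∨ e ∈ k.inner) ∧ (ty e).PosOcc m))

/-- The position `p` is one on which a token leaves the link `k`. -/
def Leaves (k : Link E) (ty : E → Formula) (p : Pos E) : Prop :=
  (∃ e m, p = Pos.atom e m ∧ ((e ∈ k.conclusions ∧ (ty e).PosOcc m) ∨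
    ((e ∈ k.premisses ∨ e ∈ k.inner) ∧ (ty e).NegOcc m))) ∨
    ∃ e ds, k = Link.box e ds ∧ p = Pos.lock e 0

theorem Trav.enters {k : Link E} {ty : E → Formula} (hk : k.WellTyped ty) {p q : Pos E}
    (h : k.Trav ty p q) : k.Enters ty p := by
  cases h with
  | ax e f m h hm => exact ⟨e, m, rfl, Or.inl ⟨by rcases h with rfl | rfl <;> simp [conclusions], hm⟩⟩
  | cut e f m h hm => exact ⟨e, m, rfl, Or.inr ⟨by rcases h with rfl | rfl <;> simp [premisses], hm⟩⟩
  | down a x c m h hm => exact ⟨a, m, rfl, Or.inr ⟨h.mem_premisses_or_inner, hm⟩⟩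
  | up a x c m h hm => exact ⟨c, _, rfl, Or.inl ⟨h.mem_conclusions, (h.negOcc_iff hk m).2 hm⟩⟩
  | unlock e ds h =>
    subst h
    exact ⟨e, [], rfl, Or.inl ⟨by simp [conclusions], by rw [hk.1]; trivial⟩⟩

theorem dual_eq_of_cut_or {k : Link E} {ty : E → Formula} (hk : k.WellTyped ty) {e f : E}
    (h : k = Link.cut e f ∨ k = Link.cut f e) : ty f = (ty e).dual := by
  rcases h with rfl | rfl
  · exact hk
  · rw [show ty e = _ from hk, Formula.dual_dual]

theorem dual_eq_of_ax_or {k : Link E} {ty : E → Formula} (hk : k.WellTyped ty) {e f : E}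
    (h : k = Link.ax e f ∨ k = Link.ax f e) : ty f = (ty e).dual := by
  rcases h with rfl | rfl
  · exact hk
  · rw [show ty e = _ from hk, Formula.dual_dual]

theorem Trav.leaves {k : Link E} {ty : E → Formula} (hk : k.WellTyped ty) {p q : Pos E}
    (h : k.Trav ty p q) : k.Leaves ty q := by
  cases h with
  | ax e f m h hm =>
    refine Or.inl ⟨f, m, rfl, Or.inl ⟨by rcases h with rfl | rfl <;> simp [conclusions], ?_⟩⟩
    rwa [dual_eq_of_ax_or hk h, Formula.posOcc_dual]
  | cut e f m h hm =>
    refine Or.inl ⟨f, m, rfl, Or.inr ⟨by rcases h with rfl | rfl <;> simp [premisses], ?_⟩⟩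
    rwa [dual_eq_of_cut_or hk h, Formula.negOcc_dual]
  | down a x c m h hm =>
    exact Or.inl ⟨c, _, rfl, Or.inl ⟨h.mem_conclusions, (h.posOcc_iff hk m).2 hm⟩⟩
  | up a x c m h hm => exact Or.inl ⟨a, m, rfl, Or.inr ⟨h.mem_premisses_or_inner, hm⟩⟩
  | unlock e ds h => exact Or.inr ⟨e, ds, h, rfl⟩

theorem Vert.not_ax {k : Link E} {a c e f : E} {x : List Dir} (h : k.Vert a x c)
    (h' : k = Link.ax e f ∨ k = Link.ax f e) : False := by
  rcases h' with rfl | rfl <;> exact h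

theorem Vert.not_cut {k : Link E} {a c e f : E} {x : List Dir} (h : k.Vert a x c)
    (h' : k = Link.cut e f ∨ k = Link.cut f e) : False := by
  rcases h' with rfl | rfl <;> exact h

theorem Vert.ne_lock {a c e : E} {x : List Dir} {ds : List (E × E)}
    (h1 : (Link.box e ds).conclusions.Nodup) (h : (Link.box e ds).Vert a x c) : c ≠ e := by
  rintro rfl
  exact (List.nodup_cons.1 h1).1 (List.mem_map.2 ⟨_, h.2, rfl⟩)

/-- The polarity of the atom fixes the direction of travel, and the absence of repeated edges on the
link then fixes the edge on the other side. -/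
theorem Trav.unique_right {k : Link E} {ty : E → Formula} (hk : k.WellTyped ty)
    (h1 : k.premisses.Nodup) (h2 : k.inner.Nodup) (h3 : k.conclusions.Nodup) {p q q' : Pos E}
    (h : k.Trav ty p q) (h' : k.Trav ty p q') : q = q' := by
  generalize hp : p = p' at h'
  cases h with
  | ax e f m h hm =>
    cases h' with
    | ax e' f' m' h' hm' =>
      cases hp
      rcases h with rfl | rfl <;> simp [conclusions] at h3 h' <;> grind
    | cut e' f' m' h' hm' => rcases h with rfl | rfl <;> simp at h'
    | down a x c m' h' hm' => exact (h'.not_ax h).elim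
    | up a x c m' h' hm' => exact (h'.not_ax h).elim
    | unlock e ds h' => rcases h with rfl | rfl <;> simp at h'
  | cut e f m h hm =>
    cases h' with
    | ax e' f' m' h' hm' => rcases h with rfl | rfl <;> simp at h'
    | cut e' f' m' h' hm' =>
      cases hp
      rcases h with rfl | rfl <;> simp [premisses] at h1 h' <;> grind
    | down a x c m' h' hm' => exact (h'.not_cut h).elim
    | up a x c m' h' hm' => exact (h'.not_cut h).elim
    | unlock e ds h' => rcases h with rfl | rfl <;> simp at h'
  | down a x c m h hm =>
    cases h' with
    | ax e' f' m' h' hm' => exact (h.not_ax h').elim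
    | cut e' f' m' h' hm' => exact (h.not_cut h').elim
    | down a' x' c' m' h' hm' =>
      cases hp
      obtain ⟨rfl, rfl⟩ := h.down_unique h1 h2 h'
      rfl
    | up a' x' c' m' h' hm' =>
      simp only [Pos.atom.injEq] at hp
      obtain ⟨rfl, rfl⟩ := hp
      exact (hm.not_negOcc ((h'.negOcc_iff hk m').2 hm')).elim
    | unlock e ds h' =>
      cases hp
      subst h'
      rw [hk.1] at hm
      exact hm.elim
  | up a x c m h hm =>
    cases h' with
    | ax e' f' m' h' hm' => exact (h.not_ax h').elim
    | cut e' f' m' h' hm' => exact (h.not_cut h').elim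
    | down a' x' c' m' h' hm' =>
      simp only [Pos.atom.injEq] at hp
      obtain ⟨rfl, rfl⟩ := hp
      exact (hm'.not_negOcc ((h.negOcc_iff hk m).2 hm)).elim
    | up a' x' c' m' h' hm' =>
      simp only [Pos.atom.injEq] at hp
      obtain ⟨rfl, hp⟩ := hp
      obtain ⟨rfl, rfl⟩ := h.up_unique h3 h' hp
      rfl
    | unlock e ds h' =>
      simp only [Pos.atom.injEq] at hp
      subst h'
      exact (h.ne_lock h3 hp.1).elim
  | unlock e ds h =>
    subst h
    cases h' with
    | ax e' f' m' h' hm' => simp at h'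
    | cut e' f' m' h' hm' => simp at h'
    | down a' x' c' m' h' hm' =>
      cases hp
      rw [hk.1] at hm'
      exact hm'.elim
    | up a' x' c' m' h' hm' =>
      simp only [Pos.atom.injEq] at hp
      exact (h'.ne_lock h3 hp.1.symm).elim
    | unlock e ds h' => cases hp; rfl

theorem Trav.unique_left {k : Link E} {ty : E → Formula} (hk : k.WellTyped ty)
    (h1 : k.premisses.Nodup) (h2 : k.inner.Nodup) (h3 : k.conclusions.Nodup) {p p' q : Pos E}
    (h : k.Trav ty p q) (h' : k.Trav ty p' q) : p = p' := by
  generalize hp : q = q' at h'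
  cases h with
  | ax e f m h hm =>
    cases h' with
    | ax e' f' m' h' hm' =>
      cases hp
      rcases h with rfl | rfl <;> simp [conclusions] at h3 h' <;> grind
    | cut e' f' m' h' hm' => rcases h with rfl | rfl <;> simp at h'
    | down a x c m' h' hm' => exact (h'.not_ax h).elim
    | up a x c m' h' hm' => exact (h'.not_ax h).elim
    | unlock e ds h' => cases hp
  | cut e f m h hm =>
    cases h' with
    | ax e' f' m' h' hm' => rcases h with rfl | rfl <;> simp at h'
    | cut e' f' m' h' hm' =>
      cases hp
      rcases h with rfl | rfl <;> simp [premisses] at h1 h' <;> grind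
    | down a x c m' h' hm' => exact (h'.not_cut h).elim
    | up a x c m' h' hm' => exact (h'.not_cut h).elim
    | unlock e ds h' => cases hp
  | down a x c m h hm =>
    cases h' with
    | ax e' f' m' h' hm' => exact (h.not_ax h').elim
    | cut e' f' m' h' hm' => exact (h.not_cut h').elim
    | down a' x' c' m' h' hm' =>
      simp only [Pos.atom.injEq] at hp
      obtain ⟨rfl, hp⟩ := hp
      obtain ⟨rfl, rfl⟩ := h.up_unique h3 h' hp
      rfl
    | up a' x' c' m' h' hm' =>
      simp only [Pos.atom.injEq] at hp
      obtain ⟨rfl, rfl⟩ := hp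
      exact (((h.posOcc_iff hk m).2 hm).not_negOcc hm').elim
    | unlock e ds h' => cases hp
  | up a x c m h hm =>
    cases h' with
    | ax e' f' m' h' hm' => exact (h.not_ax h').elim
    | cut e' f' m' h' hm' => exact (h.not_cut h').elim
    | down a' x' c' m' h' hm' =>
      simp only [Pos.atom.injEq] at hp
      obtain ⟨rfl, rfl⟩ := hp
      exact (((h'.posOcc_iff hk m').2 hm').not_negOcc hm).elim
    | up a' x' c' m' h' hm' =>
      cases hp
      obtain ⟨rfl, rfl⟩ := h.down_unique h1 h2 h'
      rfl
    | unlock e ds h' => cases hp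
  | unlock e ds h =>
    cases h' with
    | unlock e ds h' => cases hp; rfl
    | _ => cases hp

end Link

end SMLL

namespace SMLL

namespace Link

variable {E : Type}

theorem not_trav_one {ty : E → Formula} {e : E} {p q : Pos E} : ¬ (Link.one e).Trav ty p q := by
  rintro (⟨_, _, _, h | h, _⟩ | ⟨_, _, _, h | h, _⟩ | ⟨_, _, _, _, h, _⟩ | ⟨_, _, _, _, h, _⟩ |
    ⟨_, _, h⟩) <;> cases h

theorem trav_sync {L : Type} {R : Structure L E} {ps : List (E × E)} {p q : Pos E}
    (hk : (Link.sync ps).WellTyped R.ty) :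
    (Link.sync ps).Trav R.ty p q ↔ Structure.State.Cross R ps p q := by
  constructor
  · rintro (⟨_, _, _, h | h, _⟩ | ⟨_, _, _, h | h, _⟩ | ⟨a, x, c, m, ⟨rfl, h⟩, hm⟩ |
      ⟨a, x, c, m, ⟨rfl, h⟩, hm⟩ | ⟨_, _, h⟩)
    · cases h
    · cases h
    · cases h
    · cases h
    · exact .down a c m h hm
    · exact .up a c m h (by rwa [← show R.ty a = R.ty c from (hk.2 _ h).1])
    · cases h
  · rintro (⟨a, c, m, h, hm⟩ | ⟨a, c, m, h, hm⟩)
    · exact .down a [] c m ⟨rfl, h⟩ hm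
    · exact .up a [] c m ⟨rfl, h⟩ (by rwa [show R.ty a = R.ty c from (hk.2 _ h).1])

end Link

/-! ### The graph of token paths, with locks and synchronisation disregarded. -/

namespace Structure

variable {L E : Type} (R : Structure L E)

/-- `R.Next p q`: when all boxes are unlocked, a token on `p` may go to `q` next. -/
def Next (p q : Pos E) : Prop :=
  ∃ l, (R.link l).Trav R.ty p q

/-- The positions that can be reached. -/
def Reachable : Set (Pos E) :=
  {p | (∃ e m, (R.ty e).Occ m ∧ p = Pos.atom e m) ∨ ∃ e, R.IsLock e ∧ p = Pos.lock e 0}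

theorem Reachable.mem_POS {p : Pos E} (h : p ∈ R.Reachable) : p ∈ R.POS := by
  rcases h with h | ⟨e, he, rfl⟩
  · exact Or.inl h
  · exact Or.inr ⟨e, 0, he, rfl⟩

/-- `POS` may be infinite, as a lock has a position for every natural number; tokens only ever use
index `0`, which makes this set a usable bound. -/
theorem finite_reachable [Finite E] : R.Reachable.Finite := by
  have h1 : (⋃ e, (Pos.atom e) '' {m | (R.ty e).Occ m}).Finite :=
    Set.finite_iUnion fun e => (R.ty e).finite_occ.image _
  refine (h1.union (Set.finite_range fun e => Pos.lock e 0)).subset ?_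
  rintro p (⟨e, m, hm, rfl⟩ | ⟨e, -, rfl⟩)
  · exact Or.inl (Set.mem_iUnion.2 ⟨e, m, hm, rfl⟩)
  · exact Or.inr ⟨e, rfl⟩

variable {R}

theorem source_unique {e : E} {l l' : L} (h : e ∈ (R.link l).conclusions)
    (h' : e ∈ (R.link l').conclusions) : l = l' :=
  (R.source e).unique h h'

/-- Below an edge lies its target or, for a conclusion of the content of a box, that box.
`inner_iff` excludes having both. -/
theorem lower_unique {e : E} {l l' : L} (h : e ∈ (R.link l).premisses ∨ e ∈ (R.link l).inner)
    (h' : e ∈ (R.link l').premisses ∨ e ∈ (R.link l').inner) : l = l' := by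
  rcases h with h | h <;> rcases h' with h' | h'
  · exact R.target e l l' h h'
  · exact (((R.inner_iff l' e).1 h').2 l h).elim
  · exact (((R.inner_iff l e).1 h).2 l' h').elim
  · obtain ⟨⟨k, hk, he⟩, -⟩ := (R.inner_iff l e).1 h
    obtain ⟨⟨k', hk', he'⟩, -⟩ := (R.inner_iff l' e).1 h'
    rw [source_unique he he', hk'] at hk
    exact (Option.some.inj hk).symm

theorem enters_unique {p : Pos E} {l l' : L} (h : (R.link l).Enters R.ty p)
    (h' : (R.link l').Enters R.ty p) : l = l' := by
  obtain ⟨e, m, rfl, h⟩ := h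
  obtain ⟨e', m', h1, h'⟩ := h'
  cases h1
  rcases h with ⟨h, hm⟩ | ⟨h, hm⟩ <;> rcases h' with ⟨h', hm'⟩ | ⟨h', hm'⟩
  · exact source_unique h h'
  · exact (hm'.not_negOcc hm).elim
  · exact (hm.not_negOcc hm').elim
  · exact lower_unique h h'

theorem leaves_unique {p : Pos E} {l l' : L} (h : (R.link l).Leaves R.ty p)
    (h' : (R.link l').Leaves R.ty p) : l = l' := by
  rcases h with ⟨e, m, rfl, h⟩ | ⟨e, ds, h, rfl⟩ <;> rcases h' with ⟨e', m', h1, h'⟩ | ⟨e', ds', h', h1⟩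
  · cases h1
    rcases h with ⟨h, hm⟩ | ⟨h, hm⟩ <;> rcases h' with ⟨h', hm'⟩ | ⟨h', hm'⟩
    · exact source_unique h h'
    · exact (hm.not_negOcc hm').elim
    · exact (hm'.not_negOcc hm).elim
    · exact lower_unique h h'
  · cases h1
  · cases h1
  · cases h1
    exact source_unique (e := e) (by rw [h]; simp [Link.conclusions])
      (by rw [h']; simp [Link.conclusions])

theorem Next.unique_right {p q q' : Pos E} (h : R.Next p q) (h' : R.Next p q') : q = q' := by
  obtain ⟨l, h⟩ := h
  obtain ⟨l', h'⟩ := h'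
  cases enters_unique (h.enters (R.wellTyped l)) (h'.enters (R.wellTyped l'))
  exact h.unique_right (R.wellTyped l) (R.premisses_nodup l) (R.inner_nodup l)
    (R.conclusions_nodup l) h'

theorem Next.unique_left {p p' q : Pos E} (h : R.Next p q) (h' : R.Next p' q) : p = p' := by
  obtain ⟨l, h⟩ := h
  obtain ⟨l', h'⟩ := h'
  cases leaves_unique (h.leaves (R.wellTyped l)) (h'.leaves (R.wellTyped l'))
  exact h.unique_left (R.wellTyped l) (R.premisses_nodup l) (R.inner_nodup l)
    (R.conclusions_nodup l) h'

theorem Next.mem_reachable {p q : Pos E} (h : R.Next p q) : q ∈ R.Reachable := by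
  obtain ⟨l, h⟩ := h
  rcases h.leaves (R.wellTyped l) with ⟨e, m, rfl, ⟨-, h⟩ | ⟨-, h⟩⟩ | ⟨e, ds, h', rfl⟩
  · exact Or.inl ⟨e, m, Or.inl h, rfl⟩
  · exact Or.inl ⟨e, m, Or.inr h, rfl⟩
  · exact Or.inr ⟨e, ⟨l, ds, h'⟩, rfl⟩

theorem IsConclusion.not_inner {e : E} (h : R.IsConclusion e) (l : L) : e ∉ (R.link l).inner := by
  obtain ⟨⟨k, hk, he⟩, -⟩ := h
  intro h
  obtain ⟨⟨k', hk', he'⟩, -⟩ := (R.inner_iff l e).1 h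
  rw [source_unique he' he, hk] at hk'
  cases hk'

theorem Next.notMem_INIT {p q : Pos E} (h : R.Next p q) : q ∉ R.INIT := by
  rintro ⟨e, m, he, hm, rfl⟩
  obtain ⟨l, h⟩ := h
  rcases h.leaves (R.wellTyped l) with ⟨e', m', h1, ⟨-, h⟩ | ⟨h, -⟩⟩ | ⟨e, ds, h, h1⟩ <;> cases h1
  · exact h.not_negOcc hm
  · exact h.elim (he.2 l) (he.not_inner l)

theorem ty_of_link_one {l : L} {e : E} (h : R.link l = Link.one e) : R.ty e = Formula.one := by
  have := R.wellTyped l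
  rwa [h] at this

/-- With `Next.notMem_INIT`, this says that tokens are born only at the beginnings of paths, so a
new token never lands on the path of another one. -/
theorem Next.notMem_ONES {p q : Pos E} (h : R.Next p q) : q ∉ R.ONES := by
  rintro ⟨k, e, hk, rfl⟩
  obtain ⟨l, h⟩ := h
  rcases h.leaves (R.wellTyped l) with ⟨e', m', h1, ⟨h', -⟩ | ⟨-, hm⟩⟩ | ⟨e, ds, h, h1⟩ <;> cases h1
  · rw [source_unique (l' := k) h' (by rw [hk]; simp [Link.conclusions]), hk] at h
    exact Link.not_trav_one h
  · rw [ty_of_link_one hk] at hm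
    exact hm

theorem ONES_subset : R.ONES ⊆ R.Reachable := by
  rintro _ ⟨k, e, hk, rfl⟩
  exact Or.inl ⟨e, [], Or.inl (by rw [ty_of_link_one hk]; trivial), rfl⟩

theorem INIT_subset : R.INIT ⊆ R.Reachable := by
  rintro _ ⟨e, m, -, hm, rfl⟩
  exact Or.inl ⟨e, m, Or.inr hm, rfl⟩

theorem notMem_INIT_of_mem_ONES {p : Pos E} (h : p ∈ R.ONES) : p ∉ R.INIT := by
  obtain ⟨l, e, he, rfl⟩ := h
  rintro ⟨e', m, -, hm, h⟩
  cases h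
  rw [ty_of_link_one he] at hm
  exact hm

/-! ### Moves and transitions as steps along `Next`. -/

namespace State

variable {T U : R.State}

theorem Cross.trav {l : L} {ps : List (E × E)} {p q : Pos E} (hl : R.link l = Link.sync ps)
    (h : Cross R ps p q) : (R.link l).Trav R.ty p q := by
  have := R.wellTyped l
  rw [hl] at this ⊢
  exact (Link.trav_sync this).2 h

theorem Move.trav {p q : Pos E} (h : T.Move p q) :
    ∃ l, (R.link l).Trav R.ty p q ∧ ∀ ps, R.link l ≠ Link.sync ps := by
  have hc (b : L) (e : E) (ds : List (E × E)) (d c : E) (h : R.link b = Link.box e ds)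
      (hd : (d, c) ∈ ds) : R.ty d = R.ty c := by
    have := R.wellTyped b
    rw [h] at this
    exact this.2 _ hd
  cases h with
  | ax_left l e f m h hm => exact ⟨l, .ax e f m (Or.inl h) hm, by simp [h]⟩
  | ax_right l e f m h hm => exact ⟨l, .ax f e m (Or.inr h) hm, by simp [h]⟩
  | cut_left l e f m h hm => exact ⟨l, .cut e f m (Or.inl h) hm, by simp [h]⟩
  | cut_right l e f m h hm => exact ⟨l, .cut f e m (Or.inr h) hm, by simp [h]⟩
  | down_left l a b c m h hm =>
    exact ⟨l, .down a [Dir.left] c m (by rcases h with h | h <;> simp [h, Link.Vert]) hm,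
      by rcases h with h | h <;> simp [h]⟩
  | down_right l a b c m h hm =>
    exact ⟨l, .down b [Dir.right] c m (by rcases h with h | h <;> simp [h, Link.Vert]) hm,
      by rcases h with h | h <;> simp [h]⟩
  | up_left l a b c m h hm =>
    have hv : (R.link l).Vert a [Dir.left] c := by rcases h with h | h <;> simp [h, Link.Vert]
    exact ⟨l, .up a [Dir.left] c m hv ((hv.negOcc_iff (R.wellTyped l) m).1 hm),
      by rcases h with h | h <;> simp [h]⟩
  | up_right l a b c m h hm =>
    have hv : (R.link l).Vert b [Dir.right] c := by rcases h with h | h <;> simp [h, Link.Vert]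
    exact ⟨l, .up b [Dir.right] c m hv ((hv.negOcc_iff (R.wellTyped l) m).1 hm),
      by rcases h with h | h <;> simp [h]⟩
  | unlock b e ds h => exact ⟨b, .unlock e ds h, by simp [h]⟩
  | exit_box b e ds d c m h hd _ hm =>
    exact ⟨b, .down d [] c m (by rw [h]; exact ⟨rfl, hd⟩) hm, by simp [h]⟩
  | enter_box b e ds d c m h hd _ hm =>
    exact ⟨b, .up d [] c m (by rw [h]; exact ⟨rfl, hd⟩) (by rwa [hc b e ds d c h hd]), by simp [h]⟩

theorem Move.of_trav {l : L} {p q : Pos E} (h : (R.link l).Trav R.ty p q)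
    (h1 : ∀ ps, R.link l ≠ Link.sync ps)
    (h2 : ∀ e ds, R.link l = Link.box e ds → p = Pos.atom e [] ∨ T.Unlocked l) : T.Move p q := by
  have hw := R.wellTyped l
  cases h with
  | ax e f m h hm =>
    rcases h with h | h
    · exact .ax_left l e f m h hm
    · exact .ax_right l f e m h hm
  | cut e f m h hm =>
    rcases h with h | h
    · exact .cut_left l e f m h hm
    · exact .cut_right l f e m h hm
  | down a x c m h hm =>
    cases hl : R.link l <;> rw [hl] at h <;> first | exact (h1 _ hl).elim | skip
    case tensor =>
      obtain ⟨rfl, ⟨rfl, rfl⟩ | ⟨rfl, rfl⟩⟩ := h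
      · exact .down_left l _ _ _ m (Or.inl hl) hm
      · exact .down_right l _ _ _ m (Or.inl hl) hm
    case par =>
      obtain ⟨rfl, ⟨rfl, rfl⟩ | ⟨rfl, rfl⟩⟩ := h
      · exact .down_left l _ _ _ m (Or.inr hl) hm
      · exact .down_right l _ _ _ m (Or.inr hl) hm
    case box e ds =>
      obtain ⟨rfl, h⟩ := h
      rcases h2 _ _ hl with h3 | h3
      · cases h3
        rw [hl] at hw
        rw [hw.1] at hm
        exact hm.elim
      · exact .exit_box l e ds a c m hl h h3 hm
    all_goals exact h.elim
  | up a x c m h hm =>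
    have hm' := (h.negOcc_iff hw m).2 hm
    cases hl : R.link l <;> rw [hl] at h <;> first | exact (h1 _ hl).elim | skip
    case tensor =>
      obtain ⟨rfl, ⟨rfl, rfl⟩ | ⟨rfl, rfl⟩⟩ := h
      · exact .up_left l _ _ _ m (Or.inl hl) hm'
      · exact .up_right l _ _ _ m (Or.inl hl) hm'
    case par =>
      obtain ⟨rfl, ⟨rfl, rfl⟩ | ⟨rfl, rfl⟩⟩ := h
      · exact .up_left l _ _ _ m (Or.inr hl) hm'
      · exact .up_right l _ _ _ m (Or.inr hl) hm'
    case box e ds =>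
      have hn := R.conclusions_nodup l
      rw [hl] at hn
      rcases h2 _ _ hl with h3 | h3
      · simp only [Pos.atom.injEq] at h3
        exact (h.ne_lock hn h3.1).elim
      · obtain ⟨rfl, h⟩ := h
        exact .enter_box l e ds a c m hl h h3 hm'
    all_goals exact h.elim
  | unlock e ds h => exact .unlock l e ds h

theorem Step.tok_of_some (h : Step T U) {t p : Pos E} (ht : T.tok t = some p) :
    U.tok t = some p ∨ ∃ q, R.Next p q ∧ U.tok t = some q := by
  cases h with
  | move s p' q h1 h2 h3 h4 =>
    by_cases hs : t = s
    · subst hs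
      cases h1.symm.trans ht
      obtain ⟨l, hl, -⟩ := h2.trav
      exact Or.inr ⟨q, ⟨l, hl⟩, h3⟩
    · exact Or.inl ((h4 t hs).trans ht)
  | sync l ps hl h1 h2 h3 =>
    by_cases hp : ∃ q, Cross R ps p q
    · obtain ⟨q, hq⟩ := hp
      exact Or.inr ⟨q, ⟨l, hq.trav hl⟩, h2 t p q ht hq⟩
    · refine Or.inl ((h3 t fun p' q hp' hq => hp ⟨q, ?_⟩).trans ht)
      cases ht.symm.trans hp'
      exact hq
  | one l e _ _ h1 h2 h3 =>
    refine Or.inl ((h3 t fun h => ?_).trans ht)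
    rw [h, h1] at ht
    cases ht

theorem Step.tok_of_none (h : Step T U) {t : Pos E} (ht : T.tok t = none) :
    U.tok t = none ∨ t ∈ R.ONES ∧ U.tok t = some t := by
  cases h with
  | move s p' q h1 h2 h3 h4 =>
    refine Or.inl ((h4 t fun h => ?_).trans ht)
    rw [h, h1] at ht
    cases ht
  | sync l ps hl h1 h2 h3 =>
    refine Or.inl ((h3 t fun p q hp => ?_).trans ht)
    rw [ht] at hp
    cases hp
  | one l e hl _ h1 h2 h3 =>
    by_cases hs : t = Pos.atom e []
    · subst hs
      exact Or.inr ⟨⟨l, e, hl, rfl⟩, h2⟩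
    · exact Or.inl ((h3 t hs).trans ht)

theorem Cross.mem_image {l : L} {ps : List (E × E)} {p q : Pos E} (hl : R.link l = Link.sync ps)
    (h1 : ∀ e, Link.InEdge R.ty ps e → T.Saturated e) (h : Cross R ps p q) : p ∈ T.image := by
  have hw := R.wellTyped l
  rw [hl] at hw
  cases h with
  | down a c m h hm =>
    refine h1 a ⟨_, h, Or.inl ⟨?_, rfl⟩⟩ m (Or.inl hm)
    exact (hw.2 _ h).2.resolve_right fun hn => hn.not_posOcc m hm
  | up a c m h hm =>
    have := hw.2 _ h
    rw [this.1] at this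
    exact h1 c ⟨_, h, Or.inr ⟨this.2.resolve_left fun hn => hn.not_negOcc m hm, rfl⟩⟩ m (Or.inr hm)

/-- Sync links fire all or nothing: one token seen crossing forces all exit positions to be occupied
afterwards. The assumption `p ≠ q` tells a crossing from a token at rest. -/
theorem Step.cross (h : Step T U) {l : L} {ps : List (E × E)} (hl : R.link l = Link.sync ps)
    {t p q p' q' : Pos E} (ht : T.tok t = some p) (hu : U.tok t = some q) (hpq : p ≠ q)
    (hc : Cross R ps p q) (hc' : Cross R ps p' q') : q' ∈ U.image := by
  have key (h : U.tok t = T.tok t) : q' ∈ U.image := by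
    rw [ht, hu] at h
    exact (hpq (Option.some.inj h).symm).elim
  cases h with
  | move s p1 q1 h1 h2 h3 h4 =>
    by_cases hs : t = s
    · subst hs
      cases h1.symm.trans ht
      obtain ⟨k, hk, hs⟩ := h2.trav
      cases enters_unique (hk.enters (R.wellTyped k)) ((hc.trav hl).enters (R.wellTyped l))
      exact (hs _ hl).elim
    · exact key (h4 t hs)
  | sync k ps' hk h1 h2 h3 =>
    by_cases hp : ∃ p1 q1, T.tok t = some p1 ∧ Cross R ps' p1 q1
    · obtain ⟨p1, q1, h4, h5⟩ := hp
      cases ht.symm.trans h4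
      cases enters_unique ((h5.trav hk).enters (R.wellTyped k))
        ((hc.trav hl).enters (R.wellTyped l))
      cases hk.symm.trans hl
      obtain ⟨s, hs⟩ := hc'.mem_image hl h1
      exact ⟨s, h2 s _ _ hs hc'⟩
    · exact key (h3 t fun p1 q1 h4 h5 => hp ⟨p1, q1, h4, h5⟩)
  | one k e _ _ h1 h2 h3 =>
    refine key (h3 t fun h => ?_)
    rw [h, h1] at ht
    cases ht

/-! ### The invariant of visited positions, and termination. -/

/-- The states that are reached with `n` transitions, together with the set of the positions
visited on the way. -/
inductive Reach (R : Structure L E) : ℕ → R.State → Set (Pos E) → Prop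
  | init : Reach R 0 R.initialState R.INIT
  | step {n : ℕ} {T U : R.State} {V : Set (Pos E)} :
      Reach R n T V → Step T U → Reach R (n + 1) U (V ∪ U.image)

/-- The invariants of the machine, for a state and the set of the positions visited so far. -/
structure Inv (T : R.State) (V : Set (Pos E)) : Prop where
  image_subset : T.image ⊆ V
  init_subset : R.INIT ⊆ V
  subset_reachable : V ⊆ R.Reachable
  of_next : ∀ p q, R.Next p q → q ∈ V → p ∈ V ∧ p ∉ T.image
  exists_next : ∀ p ∈ V, p ∈ T.image ∨ ∃ q ∈ V, R.Next p q
  injective : ∀ s s' p, T.tok s = some p → T.tok s' = some p → s = s'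
  ones : ∀ s ∈ R.ONES, s ∈ V → T.tok s ≠ none
  path : ∀ s p, T.tok s = some p → Relation.ReflTransGen R.Next s p
  sync : ∀ l ps p q p' q', R.link l = Link.sync ps → Cross R ps p q → Cross R ps p' q' →
    q ∈ V → q' ∈ V

theorem initialState_tok {s p : Pos E} :
    R.initialState.tok s = some p ↔ s ∈ R.INIT ∧ s = p := by
  simp only [initialState]
  split_ifs with h <;> simp [h]

theorem image_initialState : R.initialState.image = R.INIT := by
  ext p
  simp [image, initialState_tok]

theorem inv_initialState : Inv R.initialState R.INIT where
  image_subset := image_initialState.subset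
  init_subset := subset_rfl
  subset_reachable := INIT_subset
  of_next p q h hq := (h.notMem_INIT hq).elim
  exists_next p hp := Or.inl (by rwa [image_initialState])
  injective s s' p h h' := (initialState_tok.1 h).2.trans (initialState_tok.1 h').2.symm
  ones s hs h := (notMem_INIT_of_mem_ONES hs h).elim
  path s p h := by rw [(initialState_tok.1 h).2]
  sync l ps p q p' q' hl h h' hq := (Next.notMem_INIT ⟨l, h.trav hl⟩ hq).elim

theorem Step.cases_tok (h : Step T U) {t p : Pos E} (ht : U.tok t = some p) :
    T.tok t = some p ∨ (∃ p0, R.Next p0 p ∧ T.tok t = some p0) ∨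
      T.tok t = none ∧ t ∈ R.ONES ∧ t = p := by
  cases hT : T.tok t with
  | none =>
    rcases h.tok_of_none hT with h1 | ⟨h1, h2⟩
    · rw [h1] at ht
      cases ht
    · exact Or.inr (Or.inr ⟨rfl, h1, Option.some.inj (h2.symm.trans ht)⟩)
  | some p0 =>
    rcases h.tok_of_some hT with h1 | ⟨q, h1, h2⟩
    · exact Or.inl (h1.symm.trans ht)
    · cases h2.symm.trans ht
      exact Or.inr (Or.inl ⟨p0, h1, rfl⟩)

/-- The fields `of_next` and `exists_next` together say that the visited positions form initial
segments of the `Next` paths, each with a token exactly at its front. -/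
theorem Inv.step {V : Set (Pos E)} (I : Inv T V) (h : Step T U) : Inv U (V ∪ U.image) where
  image_subset := Set.subset_union_right
  init_subset := I.init_subset.trans Set.subset_union_left
  subset_reachable := by
    refine Set.union_subset I.subset_reachable ?_
    rintro p ⟨t, ht⟩
    rcases h.cases_tok ht with h1 | ⟨p0, h1, -⟩ | ⟨-, h1, rfl⟩
    · exact I.subset_reachable (I.image_subset ⟨t, h1⟩)
    · exact h1.mem_reachable
    · exact ONES_subset h1
  of_next p q hpq hq := by
    -- A position once left stays empty: a token could come back only from its predecessor, which is
    -- empty too, or by a second birth, which `ones` excludes.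
    have fresh {p : Pos E} (hp : p ∈ V) (hp' : p ∉ T.image) : p ∉ U.image := by
      rintro ⟨t, ht⟩
      rcases h.cases_tok ht with h1 | ⟨p0, h1, h2⟩ | ⟨h1, h2, rfl⟩
      · exact hp' ⟨t, h1⟩
      · exact (I.of_next _ _ h1 hp).2 ⟨t, h2⟩
      · exact I.ones _ h2 hp h1
    by_cases hV : q ∈ V
    · obtain ⟨h1, h2⟩ := I.of_next p q hpq hV
      exact ⟨Or.inl h1, fresh h1 h2⟩
    · obtain ⟨t, ht⟩ := hq.resolve_left hV
      rcases h.cases_tok ht with h1 | ⟨p0, h1, h2⟩ | ⟨h1, h2, rfl⟩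
      · exact (hV (I.image_subset ⟨t, h1⟩)).elim
      · obtain rfl := h1.unique_left hpq
        have hp : p0 ∈ V := I.image_subset ⟨t, h2⟩
        refine ⟨Or.inl hp, ?_⟩
        rintro ⟨t', ht'⟩
        rcases h.cases_tok ht' with h3 | ⟨p1, h3, h4⟩ | ⟨h3, h4, rfl⟩
        · cases I.injective _ _ _ h2 h3
          cases ht.symm.trans ht'
          exact hV hp
        · exact (I.of_next _ _ h3 hp).2 ⟨t', h4⟩
        · exact I.ones _ h4 hp h3
      · exact (hpq.notMem_ONES h2).elim
  exists_next p hp := by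
    rcases hp with hp | hp
    · rcases I.exists_next p hp with ⟨t, ht⟩ | ⟨q, hq, hpq⟩
      · rcases h.tok_of_some ht with h1 | ⟨q, hq, h1⟩
        · exact Or.inl ⟨t, h1⟩
        · exact Or.inr ⟨q, Or.inr ⟨t, h1⟩, hq⟩
      · exact Or.inr ⟨q, Or.inl hq, hpq⟩
    · exact Or.inl hp
  injective := by
    have stay_moved {s s' p p0 : Pos E} (h1 : T.tok s = some p) (h2 : R.Next p0 p)
        (h3 : T.tok s' = some p0) : False :=
      (I.of_next _ _ h2 (I.image_subset ⟨s, h1⟩)).2 ⟨s', h3⟩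
    have stay_new {s s' : Pos E} (h1 : T.tok s = some s') (h2 : T.tok s' = none)
        (h3 : s' ∈ R.ONES) : False :=
      I.ones _ h3 (I.image_subset ⟨s, h1⟩) h2
    intro s s' p hs hs'
    rcases h.cases_tok hs with h1 | ⟨p0, h1, h2⟩ | ⟨h1, h2, rfl⟩ <;>
      rcases h.cases_tok hs' with h1' | ⟨p0', h1', h2'⟩ | ⟨h1', h2', h3'⟩
    · exact I.injective _ _ _ h1 h1'
    · exact (stay_moved h1 h1' h2').elim
    · subst h3'
      exact (stay_new h1 h1' h2').elim
    · exact (stay_moved h1' h1 h2).elim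
    · cases h1.unique_left h1'
      exact I.injective _ _ _ h2 h2'
    · subst h3'
      exact (h1.notMem_ONES h2').elim
    · exact (stay_new h1' h1 h2).elim
    · exact (h1'.notMem_ONES h2).elim
    · exact h3'.symm
  ones s hs hV hn := by
    have key : T.tok s ≠ none → False := by
      intro h1
      obtain ⟨p, hp⟩ := Option.ne_none_iff_exists'.1 h1
      rcases h.tok_of_some hp with h2 | ⟨q, -, h2⟩ <;>
      · rw [h2] at hn
        cases hn
    rcases hV with hV | ⟨t, ht⟩
    · exact key (I.ones s hs hV)
    · rcases h.cases_tok ht with h1 | ⟨p0, h1, h2⟩ | ⟨h1, h2, rfl⟩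
      · exact key (I.ones s hs (I.image_subset ⟨t, h1⟩))
      · exact h1.notMem_ONES hs
      · rw [ht] at hn
        cases hn
  path s p hs := by
    rcases h.cases_tok hs with h1 | ⟨p0, h1, h2⟩ | ⟨h1, h2, rfl⟩
    · exact I.path _ _ h1
    · exact (I.path _ _ h2).tail h1
    · exact .refl
  sync l ps p q p' q' hl hc hc' hq := by
    by_cases hV : q ∈ V
    · exact Or.inl (I.sync l ps p q p' q' hl hc hc' hV)
    · obtain ⟨t, ht⟩ := hq.resolve_left hV
      have hn : R.Next p q := ⟨l, hc.trav hl⟩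
      rcases h.cases_tok ht with h1 | ⟨p0, h1, h2⟩ | ⟨h1, h2, rfl⟩
      · exact (hV (I.image_subset ⟨t, h1⟩)).elim
      · cases h1.unique_left hn
        refine Or.inr (h.cross hl h2 ht ?_ hc hc')
        rintro rfl
        exact hV (I.image_subset ⟨t, h2⟩)
      · exact (hn.notMem_ONES h2).elim

/-- Had the target of a moving token been visited before, `of_next` would make the position it
leaves empty already. For a new token, `ones` plays this role. -/
theorem Inv.exists_fresh {V : Set (Pos E)} (I : Inv T V) (h : Step T U) : ∃ q ∈ U.image, q ∉ V := by
  cases h with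
  | move s p q h1 h2 h3 h4 =>
    obtain ⟨l, hl, -⟩ := h2.trav
    exact ⟨q, ⟨s, h3⟩, fun hq => (I.of_next p q ⟨l, hl⟩ hq).2 ⟨s, h1⟩⟩
  | sync l ps hl h1 h2 h3 =>
    have hw := R.wellTyped l
    rw [hl] at hw
    -- A sync link without premisses could fire forever without moving a token; `ps ≠ []` and
    -- `exists_occ` supply one that moves.
    obtain ⟨⟨a, c⟩, hac⟩ := List.exists_mem_of_ne_nil ps hw.1
    have : ∃ p q, Cross R ps p q := by
      obtain ⟨m, hm | hm⟩ := (R.ty a).exists_occ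
      · exact ⟨_, _, .down a c m hac hm⟩
      · exact ⟨_, _, .up a c m hac (by rwa [← (hw.2 _ hac).1])⟩
    obtain ⟨p, q, hpq⟩ := this
    have hp := hpq.mem_image hl h1
    obtain ⟨s, hs⟩ := hp
    exact ⟨q, ⟨s, h2 _ _ _ hs hpq⟩, fun hq => (I.of_next p q ⟨l, hpq.trav hl⟩ hq).2 ⟨s, hs⟩⟩
  | one l e hl h1 h2 h3 h4 =>
    exact ⟨_, ⟨_, h3⟩, fun hV => I.ones _ ⟨l, e, hl, rfl⟩ hV h2⟩

theorem Reach.inv {n : ℕ} {V : Set (Pos E)} (h : Reach R n T V) : Inv T V := by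
  induction h with
  | init => exact inv_initialState
  | step _ h ih => exact ih.step h

theorem Reach.le_ncard [Finite E] {n : ℕ} {V : Set (Pos E)} (h : Reach R n T V) : n ≤ V.ncard := by
  induction h with
  | init => exact Nat.zero_le _
  | @step n T U V hr h ih =>
    obtain ⟨q, hq, hV⟩ := hr.inv.exists_fresh h
    have hf := R.finite_reachable.subset (hr.inv.step h).subset_reachable
    refine Nat.succ_le_of_lt (ih.trans_lt (Set.ncard_lt_ncard ?_ hf))
    exact ⟨Set.subset_union_left, fun hs => hV (hs (Or.inr hq))⟩

theorem Reach.le_bound [Finite E] {n : ℕ} {V : Set (Pos E)} (h : Reach R n T V) :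
    n ≤ R.Reachable.ncard :=
  h.le_ncard.trans (Set.ncard_le_ncard h.inv.subset_reachable R.finite_reachable)

end State

end Structure

end SMLL

namespace SMLL

/-! ### Circulating blame and switching cycles. -/

/-- Iteration from any point meets a periodic point; its orbit is the cycle. Here `n + 1` is the
minimal period, so cyclic addition in `Fin (n + 1)` matches iteration. -/
theorem exists_injective_cycle {α : Type*} [Finite α] [Nonempty α] (f : α → α) :
    ∃ (n : ℕ) (v : Fin (n + 1) → α), Function.Injective v ∧ ∀ i, v (i + 1) = f (v i) := by
  obtain ⟨x0⟩ := ‹Nonempty α›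
  obtain ⟨x, hx⟩ : ∃ x, x ∈ Function.periodicPts f := by
    obtain ⟨m, k, hmk, h⟩ := Finite.exists_ne_map_eq_of_infinite fun n : ℕ => f^[n] x0
    wlog hlt : m < k generalizing m k
    · exact this k m hmk.symm h.symm (lt_of_le_of_ne (not_lt.1 hlt) hmk.symm)
    refine ⟨f^[m] x0, Function.mk_mem_periodicPts (Nat.sub_pos_of_lt hlt) ?_⟩
    rw [Function.IsPeriodicPt, Function.IsFixedPt, ← Function.iterate_add_apply,
      Nat.sub_add_cancel hlt.le]
    exact h.symm
  have hpos := Function.minimalPeriod_pos_of_mem_periodicPts hx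
  obtain ⟨n, hn⟩ := Nat.exists_eq_succ_of_ne_zero hpos.ne'
  refine ⟨n, fun i => f^[i] x, fun i j hij => ?_, fun i => ?_⟩
  · refine Fin.ext (Function.iterate_injOn_Iio_minimalPeriod ?_ ?_ hij) <;>
      simpa [hn] using Nat.lt_succ_iff.1 (Fin.is_lt _)
  · have h1 : ((i + 1 : Fin (n + 1)) : ℕ) = (i + 1) % Function.minimalPeriod f x := by
      rw [hn, Fin.val_add]; simp
    simp only [h1]
    rw [Function.iterate_mod_minimalPeriod_eq, Function.iterate_succ_apply']

namespace Structure

variable {L E : Type} {R : Structure L E}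

/-- If `V` is the set of the visited positions, then the source (if `b = true`) or the target
(if `b = false`) of the edge `e` is to blame for an unvisited position on `e`. -/
def Debt (R : Structure L E) (V : Set (Pos E)) (b : Bool) (e : E) : Prop :=
  (R.ty e).Owes b fun m => Pos.atom e m ∈ V

/-- The link `l'` is to blame for an unvisited position on an edge `e` that it shares with `l`. -/
def DebtEdge (R : Structure L E) (V : Set (Pos E)) (l : L) (e : E) (l' : L) : Prop :=
  (e ∈ (R.link l).premisses ∧ R.Debt V true e ∧ e ∈ (R.link l').conclusions) ∨
    (e ∈ (R.link l).conclusions ∧ R.Debt V false e ∧ e ∈ (R.link l').premisses)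

/-- The link `l` is to blame for an unvisited position on one of its edges. -/
def Debtor (R : Structure L E) (V : Set (Pos E)) (l : L) : Prop :=
  ∃ e, (e ∈ (R.link l).conclusions ∧ R.Debt V true e) ∨
    (e ∈ (R.link l).premisses ∧ R.Debt V false e)

section

variable {V : Set (Pos E)}

theorem Debt.not_false {e : E} (h : R.Debt V true e) : ¬ R.Debt V false e :=
  Formula.Owes.not_false h

theorem DebtEdge.joins {l l' : L} {e : E} (h : R.DebtEdge V l e l') : R.Joins e l l' :=
  h.elim (fun h => Or.inr ⟨h.2.2, h.1⟩) fun h => Or.inl ⟨h.1, h.2.2⟩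

theorem DebtEdge.debtor {l l' : L} {e : E} (h : R.DebtEdge V l e l') : R.Debtor V l' :=
  ⟨e, h.elim (fun h => Or.inl ⟨h.2.2, h.2.1⟩) fun h => Or.inr ⟨h.2.2, h.2.1⟩⟩

theorem DebtEdge.boxOf_eq {l l' : L} {e : E} (h : R.DebtEdge V l e l') :
    R.boxOf l' = R.boxOf l :=
  h.elim (fun h => R.premiss_level e _ _ h.2.2 h.1) fun h => (R.premiss_level e _ _ h.1 h.2.2).symm

/-- Only one end of an edge is to blame, so blame travels along it in one direction only. -/
theorem DebtEdge.unique {l k l' k' : L} {e : E} (h : R.DebtEdge V l e l')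
    (h' : R.DebtEdge V k e k') : l = k ∧ l' = k' := by
  rcases h with ⟨h1, h2, h3⟩ | ⟨h1, h2, h3⟩ <;> rcases h' with ⟨h1', h2', h3'⟩ | ⟨h1', h2', h3'⟩
  · exact ⟨R.target e _ _ h1 h1', source_unique h3 h3'⟩
  · exact (h2.not_false h2').elim
  · exact (h2'.not_false h2).elim
  · exact ⟨source_unique h1 h1', R.target e _ _ h3 h3'⟩

theorem DebtEdge.eq_or_of_mem_premisses {l l' k : L} {e : E} (h : R.DebtEdge V l e l')
    (hk : e ∈ (R.link k).premisses) : l = k ∧ R.Debt V true e ∨ l' = k ∧ R.Debt V false e := by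
  rcases h with ⟨h1, h2, h3⟩ | ⟨h1, h2, h3⟩
  · exact Or.inl ⟨R.target e _ _ h1 hk, h2⟩
  · exact Or.inr ⟨R.target e _ _ h3 hk, h2⟩

theorem not_debt_false_of_isPositive {e : E} (h : (R.ty e).IsPositive) : ¬ R.Debt V false e :=
  Formula.not_owes_false fun m hm => (h.not_negOcc m hm).elim

theorem not_debt_true_of_isNegative {e : E} (h : (R.ty e).IsNegative) : ¬ R.Debt V true e :=
  Formula.not_owes_true fun m hm => (h.not_posOcc m hm).elim

/-- An out-edge is positive with the sync link as its source, or negative with it as its target; in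
both cases the other end cannot be blamed. A cycle of blame thus enters the link through each
out-edge it uses, hence uses at most one. -/
theorem DebtEdge.eq_of_outEdge {l l' k : L} {e : E} {ps : List (E × E)}
    (h : R.DebtEdge V l e l') (hk : R.link k = Link.sync ps) (he : Link.OutEdge R.ty ps e) :
    l' = k := by
  obtain ⟨p, hp, ⟨he, rfl⟩ | ⟨he, rfl⟩⟩ := he <;> rcases h with ⟨h1, h2, h3⟩ | ⟨h1, h2, h3⟩
  · exact source_unique h3 (by rw [hk]; exact List.mem_map.2 ⟨p, hp, rfl⟩)
  · exact (not_debt_false_of_isPositive he h2).elim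
  · exact (not_debt_true_of_isNegative he h2).elim
  · exact R.target _ _ _ h3 (by rw [hk]; exact List.mem_map.2 ⟨p, hp, rfl⟩)

/-- In a net, blame cannot be passed on forever. -/
theorem IsNet.not_forall_debtEdge [Finite L] (hR : R.IsNet) (r : Option L) (P : Set L)
    (hP : P.Nonempty) (hr : ∀ l ∈ P, R.boxOf l = r)
    (h : ∀ l ∈ P, ∃ e, ∃ l' ∈ P, R.DebtEdge V l e l' ∧ ∀ a b c, R.link l = Link.par a b c →
      R.Debt V false e ∨ ¬ R.Debt V false a ∧ ¬ R.Debt V false b) : False := by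
  choose d f hf hd hpar using fun l : P => h l l.2
  have : Nonempty P := hP.to_subtype
  obtain ⟨n, v, hv, hvf⟩ := exists_injective_cycle fun l : P => (⟨f l, hf l⟩ : P)
  have hstep (i : Fin (n + 1)) : R.DebtEdge V (v i) (d (v i)) (v (i + 1)) := by
    rw [hvf]
    exact hd (v i)
  have hout {i j : Fin (n + 1)} (h : (v i : L) = v j) : i = j := hv (Subtype.ext h)
  have hin {i j : Fin (n + 1)} (h : (v (i + 1) : L) = v (j + 1)) : i = j :=
    add_right_cancel (hout h)
  refine hR r n (fun i => v i) (fun i => d (v i)) ⟨fun i => hr _ (v i).2,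
    Subtype.val_injective.comp hv, fun i j hij => ?_, fun i => (hstep i).joins, ?_, ?_⟩
  · have h1 : R.DebtEdge V (v j) (d (v i)) (v (j + 1)) := hij ▸ hstep j
    exact hout ((hstep i).unique h1).1
  · rintro l a b c hl ⟨⟨i, rfl⟩, ⟨j, rfl⟩⟩
    have hne : d (v i) ≠ d (v j) := by
      have hnd := R.premisses_nodup l
      rw [hl] at hnd
      exact fun h => (List.nodup_cons.1 hnd).1 (List.mem_singleton.2 h)
    -- Suppose both premisses of the `par` link are used. If blame leaves through both or arrives
    -- through both, injectivity of `v` is violated; if it arrives through one and leaves through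
    -- the other, `hpar` is.
    rcases (hstep i).eq_or_of_mem_premisses (k := l) (by simp [hl, Link.premisses]) with
        ⟨hi, hi'⟩ | ⟨hi, hi'⟩ <;>
      rcases (hstep j).eq_or_of_mem_premisses (k := l) (by simp [hl, Link.premisses]) with
        ⟨hj, hj'⟩ | ⟨hj, hj'⟩
    · exact hne (by rw [hout (hi.trans hj.symm)])
    · rcases hpar (v i) _ _ _ (by rw [hi]; exact hl) with h1 | h1
      · exact hi'.not_false h1
      · exact h1.2 hj'
    · rcases hpar (v j) _ _ _ (by rw [hj]; exact hl) with h1 | h1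
      · exact hj'.not_false h1
      · exact h1.1 hi'
    · exact hne (by rw [hin (hi.trans hj.symm)])
  · rintro l ps hl o o' ho ho' ⟨i, rfl⟩ ⟨j, rfl⟩
    have h1 := (hstep i).eq_of_outEdge hl ho
    have h2 := (hstep j).eq_of_outEdge hl ho'
    rw [hin (h1.trans h2.symm)]

end

/-! ### Stuck states: how blame crosses each kind of link. -/

namespace State

variable {T : R.State} {V : Set (Pos E)}

open Classical in
theorem exists_step_of_move {s p q : Pos E} (hs : T.tok s = some p) (h : T.Move p q) :
    ∃ U, Step T U := by
  obtain ⟨l, hl, -⟩ := h.trav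
  have hq : q ∈ R.POS := Reachable.mem_POS R (Next.mem_reachable ⟨l, hl⟩)
  refine ⟨⟨Function.update T.tok s (some q), ?_, fun t p' ht => ?_⟩, .move s p q hs h ?_ ?_⟩
  · obtain ⟨S, hS, hd⟩ := T.dom
    refine ⟨S, hS, fun t => ?_⟩
    rw [← hd t]
    by_cases h : t = s
    · subst h
      simp [hs]
    · simp [h]
  · by_cases h : t = s
    · subst h
      simp only [Function.update_self, Option.some.injEq] at ht
      exact ht ▸ hq
    · rw [Function.update_of_ne h] at ht
      exact T.pos t p' ht
  · simp
  · intro t ht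
    simp [ht]

open Classical in
theorem exists_step_of_one {l : L} {e : E} (hl : R.link l = Link.one e) (ha : T.Active l)
    (hT : T.tok (Pos.atom e []) = none) : ∃ U, Step T U := by
  have he : Pos.atom e [] ∈ R.ONES := ⟨l, e, hl, rfl⟩
  refine ⟨⟨Function.update T.tok (Pos.atom e []) (some (Pos.atom e [])), ?_, fun t p' ht => ?_⟩,
    .one l e hl ha hT ?_ ?_⟩
  · obtain ⟨S, hS, hd⟩ := T.dom
    refine ⟨insert (Pos.atom e []) S, Set.insert_subset he hS, fun t => ?_⟩
    by_cases h : t = Pos.atom e []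
    · subst h
      simp
    · simpa [h] using hd t
  · by_cases h : t = Pos.atom e []
    · subst h
      simp only [Function.update_self, Option.some.injEq] at ht
      exact ht ▸ Reachable.mem_POS R (ONES_subset he)
    · rw [Function.update_of_ne h] at ht
      exact T.pos t p' ht
  · simp
  · intro t ht
    simp [ht]

open Classical in
theorem exists_step_of_sync {l : L} {ps : List (E × E)} (hl : R.link l = Link.sync ps)
    (h : ∀ e, Link.InEdge R.ty ps e → T.Saturated e) : ∃ U, Step T U := by
  -- Positions that do not cross the link are fixed, so the other tokens stay.
  let c (p : Pos E) : Pos E := if h : ∃ q, Cross R ps p q then h.choose else p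
  have hc {p q : Pos E} (h : Cross R ps p q) : c p = q := by
    have h' : ∃ q, Cross R ps p q := ⟨q, h⟩
    simp only [c, dif_pos h']
    exact Next.unique_right ⟨l, h'.choose_spec.trav hl⟩ ⟨l, h.trav hl⟩
  refine ⟨⟨fun t => (T.tok t).map c, ?_, fun t p' ht => ?_⟩, .sync l ps hl h ?_ ?_⟩
  · obtain ⟨S, hS, hd⟩ := T.dom
    exact ⟨S, hS, fun t => by simp [← hd t]⟩
  · obtain ⟨p, hp, rfl⟩ := Option.map_eq_some_iff.1 ht
    by_cases h' : ∃ q, Cross R ps p q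
    · simp only [c, dif_pos h']
      exact Reachable.mem_POS R (Next.mem_reachable ⟨l, h'.choose_spec.trav hl⟩)
    · simp only [c, dif_neg h']
      exact T.pos t p hp
  · intro t p q ht hpq
    simp [ht, hc hpq]
  · intro t ht
    cases hp : T.tok t with
    | none => simp [hp]
    | some p =>
      have h' : ¬ ∃ q, Cross R ps p q := fun ⟨q, hq⟩ => ht p q hp hq
      simp [hp, c, dif_neg h']

/-- If `p` were visited and `q` not, a token would still be on `p`, free to move. -/
theorem Inv.visited_iff (I : Inv T V) (hS : ∀ U, ¬ Step T U) {l : L} {p q : Pos E}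
    (h : (R.link l).Trav R.ty p q) (hm : T.Move p q) : p ∈ V ↔ q ∈ V := by
  refine ⟨fun hp => ?_, fun hq => (I.of_next p q ⟨l, h⟩ hq).1⟩
  rcases I.exists_next p hp with ⟨s, hs⟩ | ⟨q', hq', hpq⟩
  · obtain ⟨U, hU⟩ := exists_step_of_move hs hm
    exact (hS U hU).elim
  · rwa [Next.unique_right ⟨l, h⟩ hpq]

theorem Inv.occ (I : Inv T V) {e : E} {m : List Dir} (h : Pos.atom e m ∈ V) : (R.ty e).Occ m := by
  rcases I.subset_reachable h with ⟨e', m', hm, h1⟩ | ⟨e', -, h1⟩ <;> cases h1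
  exact hm

theorem Inv.visited_vert (I : Inv T V) (hS : ∀ U, ¬ Step T U) {l : L}
    (h1 : ∀ ps, R.link l ≠ Link.sync ps)
    (h2 : ∀ e ds, R.link l = Link.box e ds → T.Unlocked l) {a c : E} {x : List Dir}
    (h : (R.link l).Vert a x c) (m : List Dir) : Pos.atom a m ∈ V ↔ Pos.atom c (x ++ m) ∈ V := by
  have hp := h.posOcc_iff (R.wellTyped l) m
  have hn := h.negOcc_iff (R.wellTyped l) m
  have key : (R.ty a).Occ m → (Pos.atom a m ∈ V ↔ Pos.atom c (x ++ m) ∈ V) := by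
    rintro (hm | hm)
    · have := Link.Trav.down a x c m h hm
      exact I.visited_iff hS this (.of_trav this h1 fun e ds hl => Or.inr (h2 e ds hl))
    · have := Link.Trav.up a x c m h hm
      exact (I.visited_iff hS this (.of_trav this h1 fun e ds hl => Or.inr (h2 e ds hl))).symm
  constructor <;> intro hV
  · exact (key (I.occ hV)).1 hV
  · refine (key ?_).2 hV
    exact (I.occ hV).imp hp.1 hn.1

/-- The same addresses have been visited on both conclusions, and duality of the types exchanges the
blamed ends. -/
theorem Inv.debt_ax (I : Inv T V) (hS : ∀ U, ¬ Step T U) {l : L} {e f : E}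
    (h : R.link l = Link.ax e f ∨ R.link l = Link.ax f e) (b : Bool) :
    R.Debt V b f ↔ R.Debt V (!b) e := by
  have hty := Link.dual_eq_of_ax_or (R.wellTyped l) h
  have h1 (e f : E) (h : R.link l = Link.ax e f ∨ R.link l = Link.ax f e) (m : List Dir)
      (hm : (R.ty e).NegOcc m) : Pos.atom e m ∈ V ↔ Pos.atom f m ∈ V := by
    have := Link.Trav.ax e f m h hm
    refine I.visited_iff hS this (.of_trav this ?_ ?_) <;> rcases h with h | h <;> simp [h]
  have h2 (m : List Dir) : Pos.atom f m ∈ V ↔ Pos.atom e m ∈ V := by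
    have hne : (R.ty f).NegOcc m ↔ (R.ty e).PosOcc m := by rw [hty, Formula.negOcc_dual]
    have hpo : (R.ty f).PosOcc m ↔ (R.ty e).NegOcc m := by rw [hty, Formula.posOcc_dual]
    constructor <;> intro hV <;> rcases I.occ hV with hm | hm
    · exact (h1 e f h m (hpo.1 hm)).2 hV
    · exact (h1 f e h.symm m hm).1 hV
    · exact (h1 f e h.symm m (hne.2 hm)).2 hV
    · exact (h1 e f h m hm).1 hV
  simp only [Debt, hty, Formula.owes_dual, h2]

theorem Inv.debt_cut (I : Inv T V) (hS : ∀ U, ¬ Step T U) {l : L} {e f : E}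
    (h : R.link l = Link.cut e f ∨ R.link l = Link.cut f e) (b : Bool) :
    R.Debt V b f ↔ R.Debt V (!b) e := by
  have hty := Link.dual_eq_of_cut_or (R.wellTyped l) h
  have h1 (e f : E) (h : R.link l = Link.cut e f ∨ R.link l = Link.cut f e) (m : List Dir)
      (hm : (R.ty e).PosOcc m) : Pos.atom e m ∈ V ↔ Pos.atom f m ∈ V := by
    have := Link.Trav.cut e f m h hm
    refine I.visited_iff hS this (.of_trav this ?_ ?_) <;> rcases h with h | h <;> simp [h]
  have h2 (m : List Dir) : Pos.atom f m ∈ V ↔ Pos.atom e m ∈ V := by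
    have hne : (R.ty f).NegOcc m ↔ (R.ty e).PosOcc m := by rw [hty, Formula.negOcc_dual]
    have hpo : (R.ty f).PosOcc m ↔ (R.ty e).NegOcc m := by rw [hty, Formula.posOcc_dual]
    constructor <;> intro hV <;> rcases I.occ hV with hm | hm
    · exact (h1 f e h.symm m hm).1 hV
    · exact (h1 e f h m (hne.1 hm)).2 hV
    · exact (h1 e f h m hm).1 hV
    · exact (h1 f e h.symm m (hpo.2 hm)).2 hV
  simp only [Debt, hty, Formula.owes_dual, h2]

theorem Inv.debt_tensor (I : Inv T V) (hS : ∀ U, ¬ Step T U) {l : L} {a b c : E}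
    (h : R.link l = Link.tensor a b c) :
    (R.Debt V true c ↔ R.Debt V true a ∨ R.Debt V true b) ∧
      (R.Debt V false c ↔ (R.Debt V false a ∨ R.Debt V false b) ∧
        ¬ R.Debt V true a ∧ ¬ R.Debt V true b) := by
  have hty := R.wellTyped l
  rw [h] at hty
  have h1 := I.visited_vert hS (l := l) (by simp [h]) (by simp [h]) (a := a) (x := [Dir.left])
    (c := c) (by simp [h, Link.Vert])
  have h2 := I.visited_vert hS (l := l) (by simp [h]) (by simp [h]) (a := b) (x := [Dir.right])
    (c := c) (by simp [h, Link.Vert])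
  simp only [List.cons_append, List.nil_append] at h1 h2
  simp only [Debt, show R.ty c = _ from hty, Formula.Owes, h1, h2, and_self]

theorem Inv.debt_par (I : Inv T V) (hS : ∀ U, ¬ Step T U) {l : L} {a b c : E}
    (h : R.link l = Link.par a b c) :
    (R.Debt V false c ↔ R.Debt V false a ∨ R.Debt V false b) ∧
      (R.Debt V true c ↔ (R.Debt V true a ∨ R.Debt V true b) ∧
        ¬ R.Debt V false a ∧ ¬ R.Debt V false b) := by
  have hty := R.wellTyped l
  rw [h] at hty
  have h1 := I.visited_vert hS (l := l) (by simp [h]) (by simp [h]) (a := a) (x := [Dir.left])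
    (c := c) (by simp [h, Link.Vert])
  have h2 := I.visited_vert hS (l := l) (by simp [h]) (by simp [h]) (a := b) (x := [Dir.right])
    (c := c) (by simp [h, Link.Vert])
  simp only [List.cons_append, List.nil_append] at h1 h2
  simp only [Debt, show R.ty c = _ from hty, Formula.Owes, h1, h2, and_self]

theorem Inv.debt_door (I : Inv T V) (hS : ∀ U, ¬ Step T U) {l : L} {e : E} {ds : List (E × E)}
    (h : R.link l = Link.box e ds) (hu : T.Unlocked l) {d c : E} (hd : (d, c) ∈ ds) (b : Bool) :
    R.Debt V b d ↔ R.Debt V b c := by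
  have hty := R.wellTyped l
  rw [h] at hty
  have h1 := I.visited_vert hS (l := l) (by simp [h]) (fun _ _ _ => hu) (a := d) (x := [])
    (c := c) (by rw [h]; exact ⟨rfl, hd⟩)
  simp only [List.nil_append] at h1
  simp only [Debt, show R.ty d = R.ty c from hty.2 _ hd, h1]

/-- The lock position has no `Next` successor, so a token that reached it is still there. -/
theorem Inv.unlocked (I : Inv T V) (hS : ∀ U, ¬ Step T U) {l : L} {e : E} {ds : List (E × E)}
    (h : R.link l = Link.box e ds) (he : Pos.atom e [] ∈ V) : T.Unlocked l := by
  have hV := (I.visited_iff hS (.unlock e ds h) (.unlock l e ds h)).1 he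
  rcases I.exists_next _ hV with h1 | ⟨q, -, k, hk⟩
  · exact ⟨e, ds, 0, h, h1⟩
  · obtain ⟨_, _, h2, -⟩ := hk.enters (R.wellTyped k)
    cases h2

/-- Some exit position is unvisited, so by the invariant `sync` none has been visited. If all entry
positions had been visited, they would all still be occupied and the link could fire. So some entry
position is unvisited, and the polarity of its in-edge puts the blame on the neighbour. -/
theorem Inv.sync_debtor (I : Inv T V) (hS : ∀ U, ¬ Step T U) {l : L} {ps : List (E × E)}
    (hl : R.link l = Link.sync ps) (h : R.Debtor V l) :
    (∃ e ∈ (R.link l).conclusions, R.Debt V false e) ∨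
      ∃ e ∈ (R.link l).premisses, R.Debt V true e := by
  have hw := R.wellTyped l
  rw [hl] at hw
  obtain ⟨p, q, hpq, hq⟩ : ∃ p q, Cross R ps p q ∧ q ∉ V := by
    by_contra! hc
    obtain ⟨e, ⟨he, hd⟩ | ⟨he, hd⟩⟩ := h <;> rw [hl] at he <;>
      obtain ⟨⟨a, c⟩, hac, rfl⟩ := List.mem_map.1 he
    · refine Formula.not_owes_true (fun m hm => ?_) hd
      exact hc _ _ (.down a c m hac (by rwa [show R.ty a = R.ty c from (hw.2 _ hac).1]))
    · refine Formula.not_owes_false (fun m hm => ?_) hd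
      exact hc _ _ (.up a c m hac (by rwa [← show R.ty a = R.ty c from (hw.2 _ hac).1]))
  obtain ⟨p', q', hpq', hp'⟩ : ∃ p q, Cross R ps p q ∧ p ∉ V := by
    by_contra! hc
    have himg {p' q' : Pos E} (h : Cross R ps p' q') : p' ∈ T.image := by
      refine (I.exists_next p' (hc _ _ h)).resolve_right ?_
      rintro ⟨q1, hq1, hn⟩
      obtain rfl := hn.unique_right ⟨l, h.trav hl⟩
      exact hq (I.sync l ps _ _ _ _ hl h hpq hq1)
    obtain ⟨U, hU⟩ : ∃ U, Step T U := by
      refine exists_step_of_sync hl ?_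
      rintro _ ⟨⟨a, c⟩, hac, ⟨hp, rfl⟩ | ⟨hn, rfl⟩⟩ m hm
      · exact himg (.down _ _ m hac (hm.resolve_right (hp.not_negOcc m)))
      · exact himg (.up _ _ m hac (hm.resolve_left (hn.not_posOcc m)))
    exact hS U hU
  have hdebt {e : E} {m : List Dir} (hm : (R.ty e).Occ m) (he : Pos.atom e m ∉ V) :
      R.Debt V true e ∨ R.Debt V false e := by
    by_contra! hc
    refine he (Formula.visited_of_not_owes (A := R.ty e) (v := fun m => Pos.atom e m ∈ V) ?_ hm)
    rintro (_ | _)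
    · exact hc.2
    · exact hc.1
  cases hpq' with
  | down a c m hac hm =>
    right
    refine ⟨a, by rw [hl]; exact List.mem_map.2 ⟨_, hac, rfl⟩,
      (hdebt (Or.inl hm) hp').resolve_right (not_debt_false_of_isPositive ?_)⟩
    exact (hw.2 _ hac).2.resolve_right fun hn => hn.not_posOcc m hm
  | up a c m hac hm =>
    left
    refine ⟨c, by rw [hl]; exact List.mem_map.2 ⟨_, hac, rfl⟩,
      (hdebt (Or.inr hm) hp').resolve_left (not_debt_true_of_isNegative ?_)⟩
    have h1 := hw.2 _ hac
    rw [h1.1] at h1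
    exact h1.2.resolve_left fun hn => hn.not_negOcc m hm

end State

/-! ### Induction on the nesting of boxes. -/

/-- Of the conclusions of the content of `r`, none has unvisited positions for which the outside
is to blame. -/
def LevelSafe (R : Structure L E) (V : Set (Pos E)) (r : Option L) : Prop :=
  ∀ e l, R.boxOf l = r → e ∈ (R.link l).conclusions → (∀ k, e ∉ (R.link k).premisses) →
    ¬ R.Debt V false e

/-- All positions on the edges of the content of `r` at depth `0` have been visited. -/
def LevelClear (R : Structure L E) (V : Set (Pos E)) (r : Option L) : Prop :=
  ∀ e l, R.boxOf l = r → e ∈ (R.link l).conclusions → ∀ b, ¬ R.Debt V b e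

namespace State

variable {T : R.State} {V : Set (Pos E)}

theorem Inv.levelSafe_of_box (I : Inv T V) (hS : ∀ U, ¬ Step T U) {l : L} (hu : T.Unlocked l)
    (h : ∀ e ∈ (R.link l).conclusions, ¬ R.Debt V false e) : R.LevelSafe V (some l) := by
  intro d k hk hd hp
  have hi := (R.inner_iff l d).2 ⟨⟨k, hk, hd⟩, hp⟩
  obtain ⟨e, ds, hl⟩ := R.boxOf_isBox k l hk
  rw [hl] at hi
  obtain ⟨⟨d, c⟩, hdc, rfl⟩ := List.mem_map.1 hi
  rw [I.debt_door hS hl hu hdc]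
  refine h c ?_
  rw [hl]
  exact List.mem_cons_of_mem _ (List.mem_map.2 ⟨_, hdc, rfl⟩)

/-- A `par` link resorts to its premisses only when it is not itself blamed through one of them, as
the switching condition requires. The assumption `hbox` is the induction hypothesis on nesting,
needed when the link is an unlocked box. -/
theorem Inv.pass_debt (I : Inv T V) (hS : ∀ U, ¬ Step T U) {l : L} (ha : T.Active l)
    (hbox : T.Unlocked l → R.LevelSafe V (some l) → R.LevelClear V (some l))
    (h : R.Debtor V l) :
    (∃ e ∈ (R.link l).conclusions, R.Debt V false e) ∨
      (∃ e ∈ (R.link l).premisses, R.Debt V true e) ∧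
        ∀ a b c, R.link l = Link.par a b c → ¬ R.Debt V false a ∧ ¬ R.Debt V false b := by
  cases hl : R.link l with
  | ax e f =>
    left
    have h1 := I.debt_ax hS (Or.inl hl) true
    have h2 := I.debt_ax hS (Or.inr hl) true
    obtain ⟨g, ⟨hg, hd⟩ | ⟨hg, hd⟩⟩ := h <;>
      simp only [hl, Link.conclusions, Link.premisses, List.mem_cons, List.not_mem_nil,
        or_false] at hg
    rcases hg with rfl | rfl
    · exact ⟨f, by simp [Link.conclusions], h2.1 hd⟩
    · exact ⟨e, by simp [Link.conclusions], h1.1 hd⟩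
  | cut e f =>
    right
    refine ⟨?_, by simp⟩
    have h1 := I.debt_cut hS (Or.inl hl) false
    have h2 := I.debt_cut hS (Or.inr hl) false
    obtain ⟨g, ⟨hg, hd⟩ | ⟨hg, hd⟩⟩ := h <;>
      simp only [hl, Link.conclusions, Link.premisses, List.mem_cons, List.not_mem_nil,
        or_false] at hg
    rcases hg with rfl | rfl
    · exact ⟨f, by simp [Link.premisses], h2.1 hd⟩
    · exact ⟨e, by simp [Link.premisses], h1.1 hd⟩
  | tensor a b c =>
    obtain ⟨h1, h2⟩ := I.debt_tensor hS hl
    obtain ⟨g, hg⟩ := h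
    simp only [hl, Link.conclusions, Link.premisses, List.mem_cons, List.not_mem_nil,
      or_false] at hg
    simp only [Link.conclusions, Link.premisses, List.mem_cons, List.not_mem_nil, or_false,
      exists_eq_left, exists_eq_or_imp, reduceCtorEq, false_imp_iff, implies_true, and_true]
    rcases hg with ⟨rfl, hd⟩ | ⟨rfl | rfl, hd⟩ <;> tauto
  | par a b c =>
    obtain ⟨h1, h2⟩ := I.debt_par hS hl
    obtain ⟨g, hg⟩ := h
    simp only [hl, Link.conclusions, Link.premisses, List.mem_cons, List.not_mem_nil,
      or_false] at hg
    simp only [Link.conclusions, Link.premisses, List.mem_cons, List.not_mem_nil, or_false,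
      exists_eq_left, exists_eq_or_imp, Link.par.injEq]
    by_cases hc : R.Debt V false c
    · exact Or.inl hc
    · right
      have hab : ¬ R.Debt V false a ∧ ¬ R.Debt V false b := by tauto
      refine ⟨?_, by rintro _ _ _ ⟨rfl, rfl, rfl⟩; exact hab⟩
      rcases hg with ⟨rfl, hd⟩ | ⟨rfl | rfl, hd⟩ <;> tauto
  | one e =>
    have hV : Pos.atom e [] ∈ V := by
      cases hT : T.tok (Pos.atom e []) with
      | none =>
        obtain ⟨U, hU⟩ := exists_step_of_one hl ha hT
        exact (hS U hU).elim
      | some p =>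
        have := I.path _ _ hT
        -- `V` is closed under predecessors, so visits trace back from the current place of the
        -- token to its birthplace.
        refine Relation.ReflTransGen.head_induction_on this (I.image_subset ⟨_, hT⟩) ?_
        exact fun h _ ih => (I.of_next _ _ h ih).1
    obtain ⟨g, ⟨hg, hd⟩ | ⟨hg, hd⟩⟩ := h <;>
      simp only [hl, Link.conclusions, Link.premisses, List.mem_cons, List.not_mem_nil,
        or_false] at hg
    subst hg
    simp only [Debt, ty_of_link_one hl, Formula.Owes] at hd
    exact (hd.2 hV).elim
  | sync ps =>
    rw [← hl]
    refine (I.sync_debtor hS hl h).imp_right fun h => ⟨h, by simp [hl]⟩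
  | box e ds =>
    left
    have hty : R.ty e = Formula.bot := by
      have := R.wellTyped l
      rw [hl] at this
      exact this.1
    by_cases hV : Pos.atom e [] ∈ V
    -- The box is unlocked. If its outside were not to blame, its content would be safe, hence
    -- clear; then no auxiliary conclusion owes anything, and the lock, of type `bot`, never blames
    -- its source.
    · by_contra! hc
      have hu := I.unlocked hS hl hV
      rw [← hl] at hc
      have hclear := hbox hu (I.levelSafe_of_box hS hu hc)
      obtain ⟨g, ⟨hg, hd⟩ | ⟨hg, hd⟩⟩ := h <;> rw [hl] at hg
      · rcases List.mem_cons.1 hg with rfl | hg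
        · simp [Debt, hty, Formula.Owes] at hd
        · obtain ⟨⟨d, c⟩, hdc, rfl⟩ := List.mem_map.1 hg
          obtain ⟨⟨k, hk, hdk⟩, -⟩ :=
            (R.inner_iff l d).1 (by rw [hl]; exact List.mem_map.2 ⟨_, hdc, rfl⟩)
          exact hclear d k hk hdk true ((I.debt_door hS hl hu hdc true).2 hd)
      · cases hg
    · refine ⟨e, by simp [Link.conclusions], ?_⟩
      simpa [Debt, hty, Formula.Owes] using hV

/-- Blame never leaves the level: `premiss_level` keeps neighbours at the same depth, and
`LevelSafe` ensures that an edge whose target side is blamed does have a target. A single debtor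
would thus start an endless chain of blame within the level. -/
theorem Inv.levelClear_of_boxes [Finite L] (hR : R.IsNet) (I : Inv T V) (hS : ∀ U, ¬ Step T U)
    {r : Option L} (ha : ∀ b, r = some b → T.Unlocked b)
    (hbox : ∀ l, R.boxOf l = r → T.Unlocked l → R.LevelSafe V (some l) → R.LevelClear V (some l))
    (hs : R.LevelSafe V r) : R.LevelClear V r := by
  have hact (l : L) (hl : R.boxOf l = r) : T.Active l := by
    cases r with
    | none => exact Or.inl hl
    | some b => exact Or.inr ⟨b, hl, ha b rfl⟩
  have hno (l : L) (hl : R.boxOf l = r) : ¬ R.Debtor V l := by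
    intro hd
    refine hR.not_forall_debtEdge (V := V) r {l | R.boxOf l = r ∧ R.Debtor V l} ⟨l, hl, hd⟩
      (fun l hl => hl.1) ?_
    rintro l ⟨hl, hd⟩
    rcases I.pass_debt hS (hact l hl) (hbox l hl) hd with ⟨e, he, hd⟩ | ⟨⟨e, he, hd⟩, hp⟩
    · have : ∃ l', e ∈ (R.link l').premisses := by
        by_contra! hc
        exact hs e l hl he hc hd
      obtain ⟨l', hl'⟩ := this
      have hde : R.DebtEdge V l e l' := Or.inr ⟨he, hd, hl'⟩
      refine ⟨e, l', ⟨hde.boxOf_eq.trans hl, hde.debtor⟩, hde, fun a b c h => Or.inl hd⟩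
    · obtain ⟨l', hl', -⟩ := R.source e
      have hde : R.DebtEdge V l e l' := Or.inl ⟨he, hd, hl'⟩
      exact ⟨e, l', ⟨hde.boxOf_eq.trans hl, hde.debtor⟩, hde, fun a b c h => Or.inr (hp a b c h)⟩
  intro e l hl he b hb
  cases b with
  | true => exact hno l hl ⟨e, Or.inl ⟨he, hb⟩⟩
  | false =>
    by_cases hc : ∃ l', e ∈ (R.link l').premisses
    · obtain ⟨l', hl'⟩ := hc
      exact hno l' ((R.premiss_level e l l' he hl').symm.trans hl) ⟨e, Or.inr ⟨hl', hb⟩⟩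
    · exact hs e l hl he (not_exists.1 hc) hb

theorem wellFounded_boxOf [Finite L] (R : Structure L E) :
    WellFounded fun k b => R.boxOf k = some b := by
  have : Std.Irrefl (Relation.TransGen fun k b => R.boxOf k = some b) := ⟨R.boxOf_acyclic⟩
  exact Subrelation.wf (r := Relation.TransGen fun k b => R.boxOf k = some b)
    (fun h => Relation.TransGen.single h)
    (Finite.wellFounded_of_trans_of_irrefl (Relation.TransGen fun k b => R.boxOf k = some b))

theorem wellFounded_boxOf_swap [Finite L] (R : Structure L E) :
    WellFounded fun b k => R.boxOf k = some b := by
  have : Std.Irrefl (Function.swap (Relation.TransGen fun k b => R.boxOf k = some b)) :=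
    ⟨R.boxOf_acyclic⟩
  have : IsTrans L (Function.swap (Relation.TransGen fun k b => R.boxOf k = some b)) :=
    ⟨fun _ _ _ h h' => h'.trans h⟩
  exact Subrelation.wf
    (r := Function.swap (Relation.TransGen fun k b => R.boxOf k = some b))
    (fun h => Relation.TransGen.single h)
    (Finite.wellFounded_of_trans_of_irrefl
      (Function.swap (Relation.TransGen fun k b => R.boxOf k = some b)))

/-- Induction from the innermost boxes outwards; unlocking and safety remain assumptions, since they
depend on the outside. -/
theorem Inv.levelClear_of_levelSafe [Finite L] (hR : R.IsNet) (I : Inv T V)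
    (hS : ∀ U, ¬ Step T U) (b : L) (hu : T.Unlocked b) (hs : R.LevelSafe V (some b)) :
    R.LevelClear V (some b) := by
  induction b using (wellFounded_boxOf R).induction with
  | _ b ih =>
    exact I.levelClear_of_boxes hR hS (by rintro _ ⟨⟩; exact hu) ih hs

/-- The assumptions are discharged from the outside inwards: at depth `0` safety holds because
`INIT` is visited, and a clear surrounding level means that the lock was visited and the doors owe
nothing. -/
theorem Inv.levelClear [Finite L] (hR : R.IsNet) (I : Inv T V) (hS : ∀ U, ¬ Step T U)
    (r : Option L) : R.LevelClear V r := by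
  have hnone : R.LevelClear V none := by
    refine I.levelClear_of_boxes hR hS (by simp) (fun l _ => I.levelClear_of_levelSafe hR hS l) ?_
    intro e l hl he hp
    exact Formula.not_owes_false fun m hm =>
      I.init_subset ⟨e, m, ⟨⟨l, hl, he⟩, hp⟩, hm, rfl⟩
  cases r with
  | none => exact hnone
  | some b =>
    induction b using (wellFounded_boxOf_swap R).induction with
    | _ b ih =>
      have hout : R.LevelClear V (R.boxOf b) := by
        cases h : R.boxOf b with
        | none => exact hnone
        | some b' => exact ih b' h
      have hc := fun e he => hout e b rfl he
      intro d k hk hd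
      obtain ⟨e, ds, hl⟩ := R.boxOf_isBox k b hk
      have hty : R.ty e = Formula.bot := by
        have := R.wellTyped b
        rw [hl] at this
        exact this.1
      have hu : T.Unlocked b := by
        refine I.unlocked hS hl ?_
        have := hc e (by simp [hl, Link.conclusions]) false
        simpa [Debt, hty, Formula.Owes] using this
      exact I.levelClear_of_levelSafe hR hS b hu
        (I.levelSafe_of_box hS hu fun e he => hc e he false) d k hk hd

theorem Inv.visited [Finite L] (hR : R.IsNet) (I : Inv T V) (hS : ∀ U, ¬ Step T U) {e : E}
    {m : List Dir} (hm : (R.ty e).Occ m) : Pos.atom e m ∈ V := by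
  obtain ⟨l, hl, -⟩ := R.source e
  exact Formula.visited_of_not_owes (I.levelClear hR hS _ e l rfl hl) hm

end State

/-! ### Ends of token paths, and the final state. -/

theorem Next.eq_of_terminal {s p p' : Pos E} (h : Relation.ReflTransGen R.Next s p)
    (h' : Relation.ReflTransGen R.Next s p') (hp : ∀ q, ¬ R.Next p q) (hp' : ∀ q, ¬ R.Next p' q) :
    p = p' := by
  rcases Relation.ReflTransGen.total_of_right_unique (fun _ _ _ h h' => h.unique_right h') h h'
    with h1 | h1
  · rcases Relation.ReflTransGen.cases_head h1 with h2 | ⟨q, h2, -⟩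
    · exact h2
    · exact (hp q h2).elim
  · rcases Relation.ReflTransGen.cases_head h1 with h2 | ⟨q, h2, -⟩
    · exact h2.symm
    · exact (hp' q h2).elim

/-- Every edge has a source, so a token going up always has a next position; a token going down
lacks one only on a conclusion of the structure. -/
theorem exists_next_of_negOcc {e : E} {m : List Dir} (hm : (R.ty e).NegOcc m) :
    ∃ q, R.Next (Pos.atom e m) q := by
  obtain ⟨l, hl, -⟩ := R.source e
  have hw := R.wellTyped l
  have hup {a : E} {x m' : List Dir} (hv : (R.link l).Vert a x e) (h : m = x ++ m') :
      ∃ q, R.Next (Pos.atom e m) q := by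
    subst h
    exact ⟨_, l, .up a x e m' hv ((hv.negOcc_iff hw m').1 hm)⟩
  cases h : R.link l with
  | ax a b =>
    simp only [h, Link.conclusions, List.mem_cons, List.not_mem_nil, or_false] at hl
    rcases hl with rfl | rfl
    · exact ⟨_, l, .ax _ _ m (Or.inl h) hm⟩
    · exact ⟨_, l, .ax _ _ m (Or.inr h) hm⟩
  | cut a b => simp [h, Link.conclusions] at hl
  | tensor a b c | par a b c =>
    simp only [h, Link.conclusions, List.mem_cons, List.not_mem_nil, or_false] at hl
    subst hl
    rw [h] at hw
    rcases m with _ | ⟨_ | _, m⟩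
    · rw [show R.ty e = _ from hw] at hm
      exact hm.elim
    · exact hup (a := a) (x := [Dir.left]) (by simp [h, Link.Vert]) rfl
    · exact hup (a := b) (x := [Dir.right]) (by simp [h, Link.Vert]) rfl
  | one a =>
    simp only [h, Link.conclusions, List.mem_cons, List.not_mem_nil, or_false] at hl
    subst hl
    rw [ty_of_link_one h] at hm
    exact hm.elim
  | sync ps =>
    rw [h] at hl
    obtain ⟨⟨a, c⟩, hac, rfl⟩ := List.mem_map.1 hl
    exact hup (a := a) (x := []) (by rw [h]; exact ⟨rfl, hac⟩) rfl
  | box e' ds =>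
    rw [h] at hl
    rcases List.mem_cons.1 hl with rfl | hl
    · rw [h] at hw
      have hm' := hm
      rw [hw.1] at hm'
      rcases m with _ | ⟨_ | _, m⟩
      · exact ⟨_, l, .unlock e ds h⟩
      · exact hm'.elim
      · exact hm'.elim
    · obtain ⟨⟨a, c⟩, hac, rfl⟩ := List.mem_map.1 hl
      exact hup (a := a) (x := []) (by rw [h]; exact ⟨rfl, hac⟩) rfl

theorem exists_next_of_posOcc {e : E} {m : List Dir} (hm : (R.ty e).PosOcc m)
    (he : ¬ R.IsConclusion e) : ∃ q, R.Next (Pos.atom e m) q := by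
  have hdown {l : L} {x : List Dir} {c : E} (hv : (R.link l).Vert e x c) :
      ∃ q, R.Next (Pos.atom e m) q :=
    ⟨_, l, .down e x c m hv hm⟩
  by_cases hp : ∃ l, e ∈ (R.link l).premisses
  · obtain ⟨l, hl⟩ := hp
    cases h : R.link l with
    | cut a b =>
      simp only [h, Link.premisses, List.mem_cons, List.not_mem_nil, or_false] at hl
      rcases hl with rfl | rfl
      · exact ⟨_, l, .cut _ _ m (Or.inl h) hm⟩
      · exact ⟨_, l, .cut _ _ m (Or.inr h) hm⟩
    | tensor a b c | par a b c =>
      simp only [h, Link.premisses, List.mem_cons, List.not_mem_nil, or_false] at hl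
      rcases hl with rfl | rfl
      · exact hdown (l := l) (x := [Dir.left]) (c := c) (by simp [h, Link.Vert])
      · exact hdown (l := l) (x := [Dir.right]) (c := c) (by simp [h, Link.Vert])
    | sync ps =>
      rw [h] at hl
      obtain ⟨⟨a, c⟩, hac, rfl⟩ := List.mem_map.1 hl
      exact hdown (l := l) (x := []) (c := c) (by rw [h]; exact ⟨rfl, hac⟩)
    | _ => simp [h, Link.premisses] at hl
  · obtain ⟨l, hl, -⟩ := R.source e
    cases hb : R.boxOf l with
    | none => exact (he ⟨⟨l, hb, hl⟩, not_exists.1 hp⟩).elim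
    | some b =>
      have hi := (R.inner_iff b e).2 ⟨⟨l, hb, hl⟩, not_exists.1 hp⟩
      obtain ⟨e', ds, h⟩ := R.boxOf_isBox l b hb
      rw [h] at hi
      obtain ⟨⟨d, c⟩, hdc, rfl⟩ := List.mem_map.1 hi
      exact hdown (l := b) (x := []) (c := c) (by rw [h]; exact ⟨rfl, hdc⟩)

theorem IsConclusion.not_next {e : E} {m : List Dir} (he : R.IsConclusion e)
    (hm : (R.ty e).PosOcc m) (q : Pos E) : ¬ R.Next (Pos.atom e m) q := by
  rintro ⟨l, h⟩
  obtain ⟨e', m', h1, ⟨-, h2⟩ | ⟨h2, -⟩⟩ := h.enters (R.wellTyped l) <;> cases h1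
  · exact hm.not_negOcc h2
  · exact h2.elim (he.2 l) (he.not_inner l)

namespace State

variable {T : R.State} {V : Set (Pos E)}

/-- An atom as successor would already be visited, so `of_next` would make `p` empty; a lock
position as successor could be entered at once, since `unlock` is unconditional. -/
theorem Inv.terminal [Finite L] (hR : R.IsNet) (I : Inv T V) (hS : ∀ U, ¬ Step T U) {p : Pos E}
    (hp : p ∈ T.image) (q : Pos E) : ¬ R.Next p q := by
  intro h
  rcases h.mem_reachable with ⟨e, m, hm, rfl⟩ | ⟨e, -, rfl⟩
  · exact (I.of_next p _ h (I.visited hR hS hm)).2 hp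
  · obtain ⟨l, h⟩ := h
    cases h with
    | unlock e ds hl =>
      obtain ⟨s, hs⟩ := hp
      obtain ⟨U, hU⟩ := exists_step_of_move hs (.unlock l e ds hl)
      exact hS U hU

theorem Inv.isFinal [Finite L] (hR : R.IsNet) (I : Inv T V) (hS : ∀ U, ¬ Step T U) :
    T.IsFinal := by
  refine ⟨T.image ∩ R.BOTBOX, Set.inter_subset_right, Set.Subset.antisymm ?_ ?_⟩
  · intro p hp
    have ht := I.terminal hR hS hp
    obtain ⟨s, hs⟩ := hp
    rcases T.pos s p hs with ⟨e, m, hm, rfl⟩ | h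
    · left
      rcases hm with hm | hm
      · refine ⟨e, m, ?_, hm, rfl⟩
        by_contra he
        obtain ⟨q, hq⟩ := exists_next_of_posOcc hm he
        exact ht q hq
      · obtain ⟨q, hq⟩ := exists_next_of_negOcc hm
        exact (ht q hq).elim
    · exact Or.inr ⟨⟨s, hs⟩, h⟩
  · rintro p (⟨e, m, he, hm, rfl⟩ | hp)
    · refine (I.exists_next _ (I.visited hR hS (Or.inl hm))).resolve_right ?_
      rintro ⟨q, -, hq⟩
      exact he.not_next hm q hq
    · exact hp.1

/-- The right-hand side mentions neither the run nor `V`, which is why all runs end in the same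
state. -/
theorem Inv.tok_iff [Finite L] (hR : R.IsNet) (I : Inv T V) (hS : ∀ U, ¬ Step T U) (s p : Pos E) :
    T.tok s = some p ↔ s ∈ R.INIT ∪ R.ONES ∧ Relation.ReflTransGen R.Next s p ∧
      ∀ q, ¬ R.Next p q := by
  obtain ⟨S, hSO, hd⟩ := T.dom
  constructor
  · intro h
    refine ⟨Set.union_subset_union_right _ hSO ((hd s).1 ⟨p, h⟩), I.path s p h, ?_⟩
    exact I.terminal hR hS ⟨s, h⟩
  · rintro ⟨hs, hsp, hp⟩
    obtain ⟨p', hp'⟩ : ∃ p', T.tok s = some p' := by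
      rcases hs with hs | hs
      · exact (hd s).2 (Or.inl hs)
      · refine Option.ne_none_iff_exists'.1 (I.ones s hs ?_)
        obtain ⟨l, e, hl, rfl⟩ := hs
        exact I.visited hR hS (Or.inl (by rw [ty_of_link_one hl]; trivial))
    rw [hp', Next.eq_of_terminal hsp (I.path _ _ hp') hp (I.terminal hR hS ⟨s, hp'⟩)]

theorem Inv.eq_of_terminal [Finite L] (hR : R.IsNet) {T' : R.State} {V' : Set (Pos E)}
    (I : Inv T V) (hS : ∀ U, ¬ Step T U) (I' : Inv T' V') (hS' : ∀ U, ¬ Step T' U) : T = T' := by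
  have : T.tok = T'.tok := by
    funext s
    refine Option.ext fun p => ?_
    rw [I.tok_iff hR hS, I'.tok_iff hR hS']
  cases T
  cases T'
  cases this
  rfl

end State

/-! ### Runs: finiteness and existence. -/

theorem IsRun.exists_reach {N : ℕ∞} {τ : ℕ → R.State} (h : R.IsRun N τ) {n : ℕ}
    (hn : (n : ℕ∞) ≤ N) : ∃ V, State.Reach R n (τ n) V := by
  induction n with
  | zero => rw [h.start]; exact ⟨_, .init⟩
  | succ n ih =>
    have hlt : (n : ℕ∞) < N := lt_of_lt_of_le (by exact_mod_cast n.lt_succ_self) hn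
    obtain ⟨V, hV⟩ := ih hlt.le
    exact ⟨_, hV.step (h.step n hlt)⟩

theorem IsRun.exists_inv [Finite E] {N : ℕ∞} {τ : ℕ → R.State} (h : R.IsRun N τ) :
    ∃ n : ℕ, N = n ∧ (∃ V, State.Inv (τ n) V) ∧ ∀ U, ¬ State.Step (τ n) U := by
  induction N using ENat.recTopCoe with
  | top =>
    obtain ⟨V, hV⟩ := h.exists_reach (n := R.Reachable.ncard + 1) le_top
    exact absurd hV.le_bound (by omega)
  | coe n =>
    obtain ⟨V, hV⟩ := h.exists_reach (n := n) le_rfl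
    exact ⟨n, rfl, ⟨V, hV.inv⟩, h.maximal n rfl⟩

-- Existence of a run supplies the final state and makes it unique; without runs, every final state
-- would satisfy the condition vacuously.
open Classical in
theorem exists_isRun [Finite E] (R : Structure L E) : ∃ N τ, R.IsRun N τ := by
  let next (T : R.State) : R.State := if h : ∃ U, State.Step T U then h.choose else T
  let τ (n : ℕ) : R.State := next^[n] R.initialState
  have hτ {n : ℕ} (h : ∃ U, State.Step (τ n) U) : State.Step (τ n) (τ (n + 1)) := by
    simp only [τ, Function.iterate_succ_apply', next] at h ⊢
    rw [dif_pos h]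
    exact h.choose_spec
  have hex : ∃ n, ∀ U, ¬ State.Step (τ n) U := by
    by_contra! hc
    -- Iteration that never gets stuck would be an infinite run, for which maximality is vacuous.
    have hrun : R.IsRun ⊤ τ := ⟨rfl, fun n _ => hτ (hc n), fun n hn => by simp at hn⟩
    obtain ⟨n, hn, -⟩ := hrun.exists_inv
    simp at hn
  refine ⟨(Nat.find hex : ℕ), τ, rfl, fun n hn => hτ ?_, fun n hn => ?_⟩
  · have := Nat.find_min hex (Nat.cast_lt.1 hn)
    push Not at this
    exact this
  · rw [← Nat.cast_injective hn]
    exact Nat.find_spec hex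

end Structure

end SMLL

theorem mainTheorem6 {L E : Type} [Finite L] [Finite E] (R : SMLL.Structure L E) (hR : R.IsNet) :
    ∃! F : R.State, F.IsFinal ∧
      ∀ (N : ℕ∞) (τ : ℕ → R.State), R.IsRun N τ → ∃ n : ℕ, N = n ∧ τ n = F := by
  obtain ⟨N, τ, h⟩ := R.exists_isRun
  obtain ⟨n, rfl, ⟨V, I⟩, hS⟩ := h.exists_inv
  refine ⟨τ n, ⟨I.isFinal hR hS, fun N' τ' h' => ?_⟩, ?_⟩
  · obtain ⟨n', rfl, ⟨V', I'⟩, hS'⟩ := h'.exists_inv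
    exact ⟨n', rfl, I'.eq_of_terminal hR hS' I hS⟩
  · rintro F ⟨-, hF⟩
    obtain ⟨n', hn, rfl⟩ := hF _ _ h
    rw [Nat.cast_injective hn]
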